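/- Let $(X_i)_{i\ge 0}$ be independent real random variables on a common probability space with $\mathbf E X_i=0$, $\mathbf E X_i^2=1$ and $\sup_{i\ge 0}\mathbf E|X_i|^k<\infty$ for every integer $k\ge 3$. For $n\ge 1$ let $C_n$ be the $n\times n$ random circulant matrix with input sequence $X_i/\sqrt n$, i.e. the matrix whose $(i,j)$ entry is $X_{(j-i)\bmod n}/\sqrt n$. Let $P_d(x)=\sum_{k=2}^d a_kx^k$ be a real polynomial, $d\ge 2$. Then $\operatorname{Tr}P_d(C_n)$ is integrable for every $n$ and, as $n\to\infty$, $$\frac{\operatorname{Tr}P_d(C_n)-\mathbf E\operatorname{Tr}P_d(C_n)}{\sqrt n}\ \longrightarrow\ N(0,\sigma_{P_d}^2)\quad\text{in distribution},$$ where $$\sigma_{P_d}^2=\sum_{\ell=2}^d a_\ell^2\,\ell!\sum_{s=0}^{\ell-1}f_\ell(s)\ \ge 0,\qquad f_\ell(s)=\frac1{(\ell-1)!}\sum_{k=0}^{s}(-1)^k\binom{\ell}{k}(s-k)^{\ell-1}.$$ (If $\sigma_{P_d}^2=0$, $N(0,0)$ is the point mass at $0$.) -/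

import Mathlib

open MeasureTheory ProbabilityTheory Filter

noncomputable section

namespace CirculantCLT

/-- The `n × n` circulant matrix with input sequence `x`: its rows are successive right circular
shifts of `(x 0, …, x (n - 1))`, so its `(i, j)` entry is `x ((j - i) mod n)`
(subtraction in `Fin n` is subtraction modulo `n`). `Matrix.circulant` has `(i, j)` entry
indexed by `i - j`, hence the transpose. -/
def circ (n : ℕ) (x : ℕ → ℝ) : Matrix (Fin n) (Fin n) ℝ :=
  (Matrix.circulant fun k : Fin n => x (k : ℕ)).transpose

theorem circ_apply (n : ℕ) (x : ℕ → ℝ) (i j : Fin n) :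
    circ n x i j = x ((j - i : Fin n) : ℕ) := rfl

/-- The random circulant matrix `C_n(ω)` with input sequence `X_i(ω) / √n`. -/
def randCirc {Ω : Type*} (X : ℕ → Ω → ℝ) (n : ℕ) (ω : Ω) : Matrix (Fin n) (Fin n) ℝ :=
  circ n fun i => X i ω / √(n : ℝ)

/-- The test polynomial `P_d(x) = ∑_{k=2}^d a_k x^k`. -/
def testPoly (d : ℕ) (a : ℕ → ℝ) : Polynomial ℝ :=
  ∑ k ∈ Finset.Icc 2 d, Polynomial.C (a k) * Polynomial.X ^ k

/-- The linear eigenvalue statistic `Tr P_d(C_n)`. -/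
def linStat {Ω : Type*} (X : ℕ → Ω → ℝ) (d : ℕ) (a : ℕ → ℝ) (n : ℕ) (ω : Ω) : ℝ :=
  Matrix.trace (Polynomial.aeval (randCirc X n ω) (testPoly d a))

/-- `f_ℓ(s) = (1 / (ℓ-1)!) ∑_{k=0}^s (-1)^k (ℓ choose k) (s-k)^{ℓ-1}`, used for `ℓ ≥ 2`. -/
def f (l s : ℕ) : ℝ :=
  (1 / ((l - 1).factorial : ℝ)) *
    ∑ k ∈ Finset.range (s + 1), (-1 : ℝ) ^ k * (l.choose k : ℝ) * ((s : ℝ) - (k : ℝ)) ^ (l - 1)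

/-- The limiting variance `σ² = ∑_{ℓ=2}^d a_ℓ² ℓ! ∑_{s=0}^{ℓ-1} f_ℓ(s)`. -/
def limVar (d : ℕ) (a : ℕ → ℝ) : ℝ :=
  ∑ l ∈ Finset.Icc 2 d, a l ^ 2 * (l.factorial : ℝ) * ∑ s ∈ Finset.range l, f l s

end CirculantCLT

end

/-!
The eigenvalue statistic divided by `√n` is `T = ∑ ℓ, b ℓ * ∑ x, ∏ s, X (x s)`, where `x` runs over
the assignments `Fin ℓ → ℤ/n` with `∑ s, x s = 0` and `b ℓ = a ℓ / √n ^ (ℓ - 1)`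
(`trace_circ_pow`, `linStat_eq`). Lévy's continuity theorem reduces the claim to the convergence of
the characteristic function `φ` of `T`, and this is obtained from Stein's method.

Fix a slot of each assignment. Let `V a` collect the terms in which the fixed slot carries the
value `a` and no other slot does, let `R` collect the terms whose fixed value is repeated, and let
`Δ a` collect all terms involving `X a`. Then `T = R + ∑ a, V a`, and `T - Δ a` is a function of the
variables other than `X a`, so that `V a` is orthogonal to `exp (i t (T - Δ a))`. Expanding
`exp (i t T)` around `T - Δ a` to first order gives
`E[T exp (i t T)] = i t E[(∑ a, V a * Δ a) exp (i t T)]` up to `E|R|` and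
`3 t ^ 2 ∑ a, E[|V a| Δ a ^ 2]` (`norm_integral_mul_exp_sub_le`). As `∑ a, V a * Δ a` concentrates
at `σ² = ∑ ℓ, a ℓ ^ 2 * ℓ!`, the function `φ` almost solves `φ' = - σ² t φ`, and integrating this
equation yields `φ t → exp (- σ² t ^ 2 / 2)`. Since `E T → 0`, centring does not change the limit.

All error terms are second or fourth moments, that is, sums of expectations of monomials over
tuples of zero-sum assignments, and only tuples taking every value at least twice contribute.
These are counted by `card_le_of_corankLE`: the number of assignments with `r` distinct values
subject to `k` linear equations in triangular form is `O(n ^ (r - k))`. The only non-negligible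
contribution to `∑ a, V a * Δ a` comes from the pairs consisting of an injective assignment and
one of its `ℓ!` permutations (`sum_matched`), which obeys a law of large numbers
(`IsFamily.integral_injZeroSum_sub_sq_le`).

Finally `f ℓ` sums to one (`sum_range_f`), which identifies `limVar` with `σ²`.
-/

set_option linter.unusedSectionVars false

namespace CirculantCLT

open Finset

/-! ### Counting solutions of triangular systems -/

section Counting

variable {A ι : Type*} [AddCommGroup A] [Fintype A] [DecidableEq A] [Fintype ι] [DecidableEq ι]

theorem card_nsmul_eq_le [IsAddCyclic A] {c : ℕ} (hc : 0 < c) (b : A) :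
    #{v : A | c • v = b} ≤ c := by
  rcases ({v : A | c • v = b} : Finset A).eq_empty_or_nonempty with h | ⟨w, hw⟩
  · simp [h]
  · refine le_trans ?_ (IsAddCyclic.card_nsmul_eq_zero_le (α := A) hc)
    refine card_le_card_of_injOn (fun v => v - w) ?_ ?_
    · intro v hv
      simp only [mem_filter, mem_univ, true_and, coe_filter, Set.mem_ofPred_eq] at hv hw ⊢
      rw [nsmul_sub, hv, hw, sub_self]
    · intro v _ v' _ h
      exact sub_left_injective h

/-- A list of sets of slots (indices of the assignment `p`) is triangular for `p` if every set
in the list contains a slot, its pivot, whose value is not taken by `p` on any set further down the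
list. -/
def Triangular {κ : Type*} (p : ι → κ) : List (Finset ι) → Prop
  | [] => True
  | B :: L => (∃ s ∈ B, ∀ B' ∈ L, ∀ s' ∈ B', p s' ≠ p s) ∧ Triangular p L

theorem Triangular.of_imp {κ κ' : Type*} {p : ι → κ} {q : ι → κ'}
    (h : ∀ s t, q s = q t → p s = p t) : ∀ {L : List (Finset ι)}, Triangular p L → Triangular q L
  | [], _ => trivial
  | _ :: _, ⟨⟨s, hs, hs'⟩, hL⟩ =>
    ⟨⟨s, hs, fun B' hB' s' hs'' heq => hs' B' hB' s' hs'' (h _ _ heq)⟩, hL.of_imp h⟩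

/-- The restriction of `p` to `D`, extended by zero. -/
def mask (D : Finset ι) (p : ι → A) : ι → A := fun s => if s ∈ D then p s else 0

theorem card_image_mask_le (D : Finset ι) (G : Finset (ι → A)) :
    #(G.image (mask D)) ≤ Fintype.card A ^ #D := by
  have : G.image (mask D) ⊆ Fintype.piFinset fun s => if s ∈ D then univ else {0} := by
    intro u hu
    obtain ⟨p, _, rfl⟩ := mem_image.1 hu
    rw [Fintype.mem_piFinset]
    intro s
    by_cases hs : s ∈ D <;> simp [mask, hs]
  refine (card_le_card this).trans_eq ?_
  rw [Fintype.card_piFinset]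
  simp only [apply_ite Finset.card, card_univ, card_singleton]
  rw [prod_ite]
  simp

/-- Elimination of one pivot: given the values outside the pivot class, one equation leaves at most
`card ι` choices for the value of the pivot class. -/
theorem card_image_mask_le_erase [IsAddCyclic A] (ρ : ι → ι) (B D : Finset ι) (G : Finset (ι → A))
    (hρ : ∀ p ∈ G, ∀ s, p (ρ s) = p s) (hB : ∀ p ∈ G, ∑ s ∈ B, p s = 0)
    (hD : ∀ s ∈ B, ρ s ∈ D) {s₀ : ι} (hs₀ : s₀ ∈ B) :
    #(G.image (mask D)) ≤ (Fintype.card ι + 1) * #(G.image (mask (D.erase (ρ s₀)))) := by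
  set t := ρ s₀
  have himg : (G.image (mask D)).image (mask (D.erase t)) = G.image (mask (D.erase t)) := by
    rw [image_image]
    congr 1
    funext p s
    by_cases hs : s = t <;> by_cases hs' : s ∈ D <;> simp [mask, hs, hs']
  rw [← himg]
  refine card_le_mul_card_image _ _ fun a ha => ?_
  set c := #{s ∈ B | ρ s = t}
  have hc : 0 < c := card_pos.2 ⟨s₀, by simp [hs₀, t]⟩
  have hcN : c ≤ Fintype.card ι + 1 := (card_le_univ _).trans (Nat.le_succ _)
  refine le_trans ?_ ((card_nsmul_eq_le hc (-∑ s ∈ B with ρ s ≠ t, a (ρ s))).trans hcN)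
  refine card_le_card_of_injOn (fun u => u t) ?_ ?_
  · intro u hu
    simp only [coe_filter, Set.mem_ofPred_eq, mem_image] at hu
    obtain ⟨⟨p, hp, rfl⟩, rfl⟩ := hu
    simp only [coe_filter, mem_univ, true_and, Set.mem_ofPred_eq]
    rw [eq_neg_iff_add_eq_zero, ← hB p hp, ← sum_filter_add_sum_filter_not B (fun s => ρ s = t)]
    congr 1
    · rw [← sum_const]
      refine sum_congr rfl fun s hs => ?_
      have h1 := (mem_filter.1 hs).2
      have h2 : t ∈ D := hD _ hs₀
      rw [← hρ p hp s, h1]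
      simp [mask, h2]
    · refine sum_congr rfl fun s hs => ?_
      have h1 := (mem_filter.1 hs)
      have h2 := hD _ h1.1
      rw [← hρ p hp s]
      simp [mask, h2, h1.2]
  · intro u hu v hv huv
    simp only [coe_filter, Set.mem_ofPred_eq, mem_image] at hu hv
    obtain ⟨⟨p, hp, rfl⟩, hu⟩ := hu
    obtain ⟨⟨q, hq, rfl⟩, hv⟩ := hv
    funext s
    by_cases hs : s = t
    · rw [hs]; exact huv
    · have := congrFun (hu.trans hv.symm) s
      by_cases hD' : s ∈ D
      · simpa [mask, hs, hD'] using this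
      · simp [mask, hD']

theorem pow_mul_card_image_mask_le [IsAddCyclic A] (ρ : ι → ι) (G : Finset (ι → A))
    (hρ : ∀ p ∈ G, ∀ s, p (ρ s) = p s) :
    ∀ (L : List (Finset ι)) (D : Finset ι), (∀ p ∈ G, ∀ B ∈ L, ∑ s ∈ B, p s = 0) →
      Triangular ρ L → (∀ B ∈ L, ∀ s ∈ B, ρ s ∈ D) →
      Fintype.card A ^ L.length * #(G.image (mask D)) ≤
        (Fintype.card ι + 1) ^ L.length * Fintype.card A ^ #D
  | [], D, _, _, _ => by simpa using card_image_mask_le D G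
  | B :: L, D, hG, ⟨⟨s, hs, hpiv⟩, hL⟩, hD => by
    have ih := pow_mul_card_image_mask_le ρ G hρ L (D.erase (ρ s))
      (fun p hp B' hB' => hG p hp B' (List.mem_cons_of_mem _ hB')) hL
      (fun B' hB' s' hs' => mem_erase.2
        ⟨hpiv B' hB' s' hs', hD B' (List.mem_cons_of_mem _ hB') s' hs'⟩)
    have step := card_image_mask_le_erase ρ B D G hρ (fun p hp => hG p hp B List.mem_cons_self)
      (hD B List.mem_cons_self) hs
    have hcard : #D = #(D.erase (ρ s)) + 1 :=
      (card_erase_add_one (hD B List.mem_cons_self s hs)).symm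
    rw [hcard, List.length_cons]
    calc Fintype.card A ^ (L.length + 1) * #(G.image (mask D))
        ≤ Fintype.card A ^ (L.length + 1) *
            ((Fintype.card ι + 1) * #(G.image (mask (D.erase (ρ s))))) := by gcongr
      _ = (Fintype.card A * (Fintype.card ι + 1)) *
            (Fintype.card A ^ L.length * #(G.image (mask (D.erase (ρ s))))) := by ring
      _ ≤ (Fintype.card A * (Fintype.card ι + 1)) *
            ((Fintype.card ι + 1) ^ L.length * Fintype.card A ^ #(D.erase (ρ s))) := by gcongr
      _ = _ := by ring

/-- An assignment `p : ι → A` has corank at most `e` if some triangular list of at most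
three zero-sum equations satisfied by `p` cuts its number of distinct values down to `e`. -/
def CorankLE (p : ι → A) (e : ℕ) : Prop :=
  ∃ L : List (Finset ι), L.length ≤ 3 ∧ (∀ B ∈ L, ∑ s ∈ B, p s = 0) ∧ Triangular p L ∧
    #(univ.image p) ≤ e + L.length

variable (ι) in
/-- The constant of the counting bound `card_le_of_corankLE`. -/
noncomputable def countConst : ℕ :=
  #((List.finite_length_le (Finset ι) 3).toFinset ×ˢ (univ : Finset (ι → ι))) *
    (Fintype.card ι + 1) ^ 3

/-- Assignments of corank at most `e` number `O(|A|^e)`: the kernel of `p` is one of finitely many,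
and each triangular equation determines the value of its pivot up to boundedly many choices, because
`c • v = b` has at most `c` solutions in a cyclic group. -/
theorem card_le_of_corankLE [IsAddCyclic A] (F : Finset (ι → A)) (e : ℕ)
    (h : ∀ p ∈ F, CorankLE p e) : #F ≤ countConst ι * Fintype.card A ^ e := by
  classical
  have hA : 0 < Fintype.card A := Fintype.card_pos_iff.2 ⟨0⟩
  let cls : List (Finset ι) × (ι → ι) → Finset (ι → A) := fun c =>
    {p ∈ F | (∀ s, p (c.2 s) = p s) ∧ (∀ B ∈ c.1, ∑ s ∈ B, p s = 0) ∧ Triangular c.2 c.1 ∧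
      #(univ.image c.2) ≤ e + c.1.length}
  have hcover : F ⊆ ((List.finite_length_le (Finset ι) 3).toFinset ×ˢ univ).biUnion cls := by
    intro p hp
    obtain ⟨L, hlen, hsum, htri, hcard⟩ := h p hp
    let ρ : ι → ι := fun s => @Function.invFun _ _ ⟨s⟩ p (p s)
    have hρ : ∀ s, p (ρ s) = p s := fun s => @Function.invFun_eq _ _ ⟨s⟩ p _ ⟨s, rfl⟩
    have hρ' : ∀ s t, ρ s = ρ t → p s = p t := fun s t hst => by rw [← hρ s, ← hρ t, hst]
    refine mem_biUnion.2 ⟨(L, ρ), by simpa using hlen, mem_filter.2 ⟨hp, hρ, hsum,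
      htri.of_imp hρ', le_trans ?_ hcard⟩⟩
    refine card_le_card_of_injOn p (fun t _ => by simp) ?_
    intro t ht t' ht' htt'
    simp only [coe_image, coe_univ, Set.image_univ, Set.mem_range] at ht ht'
    obtain ⟨s, rfl⟩ := ht
    obtain ⟨s', rfl⟩ := ht'
    rw [hρ, hρ] at htt'
    simp only [ρ]
    rw [htt']
  refine (card_le_card hcover).trans (card_biUnion_le_card_mul _ _
    ((Fintype.card ι + 1) ^ 3 * Fintype.card A ^ e) ?_ |>.trans_eq
      (by rw [countConst, mul_assoc]))
  rintro ⟨L, ρ⟩ hLρ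
  have hlen : L.length ≤ 3 := by simpa using hLρ
  rcases (cls (L, ρ)).eq_empty_or_nonempty with hemp | ⟨p₀, hp₀⟩
  · simp [hemp]
  obtain ⟨-, -, -, htri, hcard⟩ := mem_filter.1 hp₀
  have hmask : Set.InjOn (mask (univ.image ρ)) (cls (L, ρ) : Set (ι → A)) := by
    intro p hp q hq hpq
    have hp := (mem_filter.1 (mem_coe.1 hp)).2.1
    have hq := (mem_filter.1 (mem_coe.1 hq)).2.1
    funext s
    have := congrFun hpq (ρ s)
    simp only [mask, mem_image, mem_univ, true_and, exists_apply_eq_apply, if_true] at this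
    rw [← hp s, ← hq s, this]
  have key := pow_mul_card_image_mask_le ρ (cls (L, ρ)) (fun p hp => (mem_filter.1 hp).2.1) L
    (univ.image ρ) (fun p hp => (mem_filter.1 hp).2.2.1) htri (fun B _ s _ => by simp)
  rw [card_image_of_injOn hmask] at key
  refine Nat.le_of_mul_le_mul_left (key.trans ?_) (pow_pos hA L.length)
  calc (Fintype.card ι + 1) ^ L.length * Fintype.card A ^ #(univ.image ρ)
      ≤ (Fintype.card ι + 1) ^ 3 * Fintype.card A ^ (e + L.length) := by
        gcongr
        · omega
    _ = _ := by ring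

/-- If every value of `p` is taken at least twice outside `E`, then `p` has few distinct values. -/
theorem two_mul_card_image_add_le {κ : Type*} [DecidableEq κ] (p : ι → κ) (E : Finset ι)
    (h : ∀ s, ∃ t t', t ≠ t' ∧ t ∉ E ∧ t' ∉ E ∧ p t = p s ∧ p t' = p s) :
    2 * #(univ.image p) + #E ≤ Fintype.card ι := by
  have himg : univ.image p = Eᶜ.image p := by
    ext a
    simp only [mem_image, mem_univ, true_and, mem_compl]
    constructor
    · rintro ⟨s, rfl⟩
      obtain ⟨t, _, _, ht, _, hts, _⟩ := h s
      exact ⟨t, ht, hts⟩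
    · rintro ⟨s, _, rfl⟩
      exact ⟨s, rfl⟩
  have := mul_card_image_le_card (s := Eᶜ) (f := p) 2 ?_
  · rw [himg]
    have h2 := card_compl_add_card E
    omega
  · intro a ha
    obtain ⟨s, -, rfl⟩ := mem_image.1 ha
    obtain ⟨t, t', hne, ht, ht', h1, h2⟩ := h s
    rw [← card_pair hne]
    refine card_le_card ?_
    intro u hu
    simp only [mem_insert, mem_singleton] at hu
    rcases hu with rfl | rfl <;> simp [*]

theorem exists_value_notMem {κ : Type*} [DecidableEq κ] (p : ι → κ) (S : Finset ι)
    (h : #(S.image p) < #(univ.image p)) : ∃ s, ∀ s' ∈ S, p s' ≠ p s := by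
  by_contra! hcon
  refine absurd (card_le_card ?_) (not_le.2 h)
  intro a ha
  obtain ⟨s, -, rfl⟩ := mem_image.1 ha
  obtain ⟨s', hs', h'⟩ := hcon s
  exact mem_image.2 ⟨s', hs', h'⟩

theorem corankLE_of_one {p : ι → A} {e : ℕ} {B : Finset ι} (hB : B.Nonempty)
    (h0 : ∑ s ∈ B, p s = 0) (h : #(univ.image p) ≤ e + 1) : CorankLE p e := by
  obtain ⟨s, hs⟩ := hB
  exact ⟨[B], by simp, by simpa using h0, ⟨⟨s, hs, by simp⟩, trivial⟩, by simpa using h⟩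

theorem corankLE_of_two {p : ι → A} {e : ℕ} {B B' : Finset ι} (hB' : B'.Nonempty)
    (h0 : ∑ s ∈ B, p s = 0) (h0' : ∑ s ∈ B', p s = 0) {s : ι} (hs : s ∈ B)
    (hpiv : ∀ s' ∈ B', p s' ≠ p s) (h : #(univ.image p) ≤ e + 2) : CorankLE p e := by
  obtain ⟨t, ht⟩ := hB'
  refine ⟨[B, B'], by simp, by simp [h0, h0'], ⟨⟨s, hs, by simpa using hpiv⟩, ⟨t, ht, by simp⟩,
    trivial⟩, by simpa using h⟩

theorem corankLE_of_three {p : ι → A} {e : ℕ} {B B' B'' : Finset ι} (hB'' : B''.Nonempty)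
    (h0 : ∑ s ∈ B, p s = 0) (h0' : ∑ s ∈ B', p s = 0) (h0'' : ∑ s ∈ B'', p s = 0)
    {s s' : ι} (hs : s ∈ B) (hs' : s' ∈ B') (hpiv : ∀ u ∈ B', p u ≠ p s)
    (hpiv' : ∀ u ∈ B'', p u ≠ p s) (hpiv'' : ∀ u ∈ B'', p u ≠ p s')
    (h : #(univ.image p) ≤ e + 3) : CorankLE p e := by
  obtain ⟨t, ht⟩ := hB''
  refine ⟨[B, B', B''], by simp, by simp [h0, h0', h0''], ⟨⟨s, hs, ?_⟩, ⟨s', hs', ?_⟩,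
    ⟨t, ht, by simp⟩, trivial⟩, by simpa using h⟩
  · intro C hC
    simp only [List.mem_cons, List.not_mem_nil, or_false] at hC
    rcases hC with rfl | rfl
    exacts [hpiv, hpiv']
  · simpa using hpiv''

end Counting

/-! ### Moments of monomials -/

section Moments

variable {Ω : Type*} [MeasurableSpace Ω] {μ : Measure Ω}

/-- A measurable real random variable all of whose absolute moments are finite. -/
def HasMoments (μ : Measure Ω) (f : Ω → ℝ) : Prop :=
  Measurable f ∧ ∀ k : ℕ, Integrable (fun ω => |f ω| ^ k) μ

namespace HasMoments

variable {f g : Ω → ℝ}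

theorem integrable_pow (hf : HasMoments μ f) (k : ℕ) : Integrable (fun ω => f ω ^ k) μ :=
  (hf.2 k).mono' (hf.1.pow_const k).aestronglyMeasurable (ae_of_all _ fun ω => by simp)

theorem integrable (hf : HasMoments μ f) : Integrable f μ := by
  simpa using hf.integrable_pow 1

theorem const [IsFiniteMeasure μ] (c : ℝ) : HasMoments μ fun _ => c :=
  ⟨measurable_const, fun _ => integrable_const _⟩

theorem abs (hf : HasMoments μ f) : HasMoments μ fun ω => |f ω| :=
  ⟨hf.1.abs, fun k => by simpa using hf.2 k⟩

theorem mul (hf : HasMoments μ f) (hg : HasMoments μ g) : HasMoments μ fun ω => f ω * g ω := by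
  refine ⟨hf.1.mul hg.1, fun k => ?_⟩
  refine ((hf.2 (2 * k)).add (hg.2 (2 * k))).mono'
    ((hf.1.mul hg.1).abs.pow_const k).aestronglyMeasurable (ae_of_all _ fun ω => ?_)
  simp only [Pi.add_apply, Real.norm_eq_abs, abs_pow, abs_abs, abs_mul, pow_mul', mul_pow]
  nlinarith [sq_nonneg (|f ω| ^ k - |g ω| ^ k), sq_nonneg (|f ω| ^ k), sq_nonneg (|g ω| ^ k)]

theorem add (hf : HasMoments μ f) (hg : HasMoments μ g) : HasMoments μ fun ω => f ω + g ω := by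
  refine ⟨hf.1.add hg.1, fun k => ?_⟩
  refine (((hf.2 k).add (hg.2 k)).const_mul (2 ^ k)).mono'
    ((hf.1.add hg.1).abs.pow_const k).aestronglyMeasurable (ae_of_all _ fun ω => ?_)
  simp only [Pi.add_apply, Real.norm_eq_abs, abs_pow, abs_abs]
  have h1 : |f ω + g ω| ≤ 2 * max |f ω| |g ω| := by
    refine (abs_add_le _ _).trans ?_
    linarith [le_max_left |f ω| |g ω|, le_max_right |f ω| |g ω|]
  calc |f ω + g ω| ^ k ≤ (2 * max |f ω| |g ω|) ^ k := by gcongr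
    _ = 2 ^ k * (max |f ω| |g ω|) ^ k := mul_pow _ _ _
    _ ≤ _ := by
      gcongr
      rcases max_cases |f ω| |g ω| with ⟨h, -⟩ | ⟨h, -⟩ <;> rw [h]
      · linarith [pow_nonneg (abs_nonneg (g ω)) k]
      · linarith [pow_nonneg (abs_nonneg (f ω)) k]

theorem const_mul [IsFiniteMeasure μ] (hf : HasMoments μ f) (c : ℝ) :
    HasMoments μ fun ω => c * f ω :=
  (HasMoments.const c).mul hf

theorem sub [IsFiniteMeasure μ] (hf : HasMoments μ f) (hg : HasMoments μ g) :
    HasMoments μ fun ω => f ω - g ω := by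
  simpa [sub_eq_add_neg] using hf.add (hg.const_mul (-1))

theorem pow [IsFiniteMeasure μ] (hf : HasMoments μ f) (k : ℕ) :
    HasMoments μ fun ω => f ω ^ k :=
  ⟨hf.1.pow_const k, fun j => by simpa [← pow_mul] using hf.2 (k * j)⟩

theorem sum [IsFiniteMeasure μ] {α : Type*} (s : Finset α) {f : α → Ω → ℝ}
    (hf : ∀ a ∈ s, HasMoments μ (f a)) : HasMoments μ fun ω => ∑ a ∈ s, f a ω := by
  classical
  induction s using Finset.induction_on with
  | empty => simpa using HasMoments.const (μ := μ) 0
  | insert a s ha ih =>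
    simp only [sum_insert ha]
    exact (hf a (mem_insert_self _ _)).add (ih fun b hb => hf b (mem_insert_of_mem hb))

theorem prod [IsFiniteMeasure μ] {α : Type*} (s : Finset α) {f : α → Ω → ℝ}
    (hf : ∀ a ∈ s, HasMoments μ (f a)) : HasMoments μ fun ω => ∏ a ∈ s, f a ω := by
  classical
  induction s using Finset.induction_on with
  | empty => simpa using HasMoments.const (μ := μ) 1
  | insert a s ha ih =>
    simp only [prod_insert ha]
    exact (hf a (mem_insert_self _ _)).mul (ih fun b hb => hf b (mem_insert_of_mem hb))

end HasMoments

/-- Independent, centred, normalised random variables with absolute moments bounded by `M`. -/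
structure IsFamily {A : Type*} (μ : Measure Ω) (M : ℕ → ℝ) (Y : A → Ω → ℝ) : Prop where
  indep : iIndepFun Y μ
  mean : ∀ a, ∫ ω, Y a ω ∂μ = 0
  var : ∀ a, ∫ ω, Y a ω ^ 2 ∂μ = 1
  hasMoments : ∀ a, HasMoments μ (Y a)
  bound : ∀ k a, ∫ ω, |Y a ω| ^ k ∂μ ≤ M k

variable {A ι κ : Type*} [Fintype ι] [Fintype κ] {Y : A → Ω → ℝ} {M : ℕ → ℝ}

/-- The monomial `∏ s, Y (p s)`. -/
def mon (Y : A → Ω → ℝ) (p : ι → A) (ω : Ω) : ℝ := ∏ s, Y (p s) ω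

theorem mon_sumElim (p : ι → A) (q : κ → A) (ω : Ω) :
    mon Y (Sum.elim p q) ω = mon Y p ω * mon Y q ω := by
  simp [mon, Fintype.prod_sum_type]

variable [IsProbabilityMeasure μ]

theorem IsFamily.hasMoments_mon (hY : IsFamily μ M Y) (p : ι → A) : HasMoments μ (mon Y p) :=
  HasMoments.prod _ fun _ _ => hY.hasMoments _

/-- A bound for the expectations of all monomials of degree `N`. -/
def momConst (M : ℕ → ℝ) (N : ℕ) : ℝ := 1 + N * |M N|

theorem momConst_nonneg (M : ℕ → ℝ) (N : ℕ) : 0 ≤ momConst M N := by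
  unfold momConst; positivity

theorem IsFamily.abs_integral_mon_le (hY : IsFamily μ M Y) (p : ι → A) :
    |∫ ω, mon Y p ω ∂μ| ≤ momConst M (Fintype.card ι) := by
  set N := Fintype.card ι with hN
  have hpt : ∀ ω, |mon Y p ω| ≤ 1 + ∑ s, |Y (p s) ω| ^ N := by
    intro ω
    rw [mon, abs_prod]
    rcases isEmpty_or_nonempty ι with h | h
    · simp
    · obtain ⟨s₀, -, hs₀⟩ := exists_max_image univ (fun s => |Y (p s) ω|) univ_nonempty
      calc ∏ s, |Y (p s) ω| ≤ ∏ _s : ι, |Y (p s₀) ω| :=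
            prod_le_prod (fun _ _ => abs_nonneg _) fun s hs => hs₀ s hs
        _ = |Y (p s₀) ω| ^ N := by simp [hN]
        _ ≤ ∑ s, |Y (p s) ω| ^ N :=
            single_le_sum (f := fun s => |Y (p s) ω| ^ N) (fun s _ => by positivity) (mem_univ s₀)
        _ ≤ _ := by linarith
  have hint : Integrable (fun ω => ∑ s, |Y (p s) ω| ^ N) μ :=
    integrable_finsetSum _ fun s _ => (hY.hasMoments _).2 N
  calc |∫ ω, mon Y p ω ∂μ| ≤ ∫ ω, |mon Y p ω| ∂μ := abs_integral_le_integral_abs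
    _ ≤ ∫ ω, (1 + ∑ s, |Y (p s) ω| ^ N) ∂μ :=
        integral_mono (hY.hasMoments_mon p).abs.integrable ((integrable_const _).add hint) hpt
    _ = 1 + ∑ s, ∫ ω, |Y (p s) ω| ^ N ∂μ := by
        rw [integral_add (integrable_const _) hint,
          integral_finsetSum _ fun s _ => (hY.hasMoments _).2 N]
        simp
    _ ≤ 1 + ∑ _s : ι, |M N| := by
        gcongr with s
        exact (hY.bound N _).trans (le_abs_self _)
    _ = _ := by simp [momConst, hN]

/-- A function of the family that ignores the coordinate `i` is independent of `Y i`. -/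
theorem IsFamily.integral_mul_eq_zero [Fintype A] [DecidableEq A] (hY : IsFamily μ M Y) (i : A)
    {f : (A → ℝ) → ℂ} (hf : Measurable f) (hi : ∀ y, f (Function.update y i 0) = f y) :
    ∫ ω, (Y i ω : ℂ) * f (fun a => Y a ω) ∂μ = 0 := by
  have hind := hY.indep.indepFun_finset {i} (univ.erase i) (by simp)
    fun a => (hY.hasMoments a).1
  let g : ({a // a ∈ (univ : Finset A).erase i} → ℝ) → ℂ := fun z =>
    f fun a => if h : a ∈ univ.erase i then z ⟨a, h⟩ else 0
  have hg : Measurable g := by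
    refine hf.comp (measurable_pi_lambda _ fun a => ?_)
    by_cases h : a ∈ univ.erase i
    · simp only [h, dite_true]; exact measurable_pi_apply _
    · simp only [h, dite_false]; exact measurable_const
  have hgf : ∀ ω, g (fun a => Y a ω) = f fun a => Y a ω := by
    intro ω
    rw [← hi fun a => Y a ω]
    simp only [g]
    congr 1
    funext a
    by_cases h : a = i
    · subst h; simp
    · simp [h]
  let e : ({a // a ∈ ({i} : Finset A)} → ℝ) → ℂ := fun z => (z ⟨i, mem_singleton_self i⟩ : ℂ)
  have he : Measurable e := Complex.measurable_ofReal.comp (measurable_pi_apply _)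
  have hind' := hind.comp he hg
  have hm : ∀ S : Finset A, Measurable fun ω => fun a : S => Y a ω := fun S =>
    measurable_pi_lambda _ fun a => (hY.hasMoments a).1
  have := hind'.integral_fun_mul_eq_mul_integral (he.comp (hm _)).aestronglyMeasurable
    (hg.comp (hm _)).aestronglyMeasurable
  simp only [Function.comp_apply, e] at this
  rw [integral_complex_ofReal, hY.mean, Complex.ofReal_zero, zero_mul] at this
  rw [← this]
  exact integral_congr_ae (ae_of_all _ fun ω => by simp only [hgf])

theorem IsFamily.integral_mon_eq_zero [Fintype A] [DecidableEq A] [DecidableEq ι]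
    (hY : IsFamily μ M Y) (p : ι → A) {s : ι} (hs : ∀ s', s' ≠ s → p s' ≠ p s) :
    ∫ ω, mon Y p ω ∂μ = 0 := by
  have := hY.integral_mul_eq_zero (p s) (f := fun y => ((∏ t ∈ univ.erase s, y (p t) : ℝ) : ℂ))
    (Complex.measurable_ofReal.comp
      (Finset.measurable_fun_prod _ fun t _ => measurable_pi_apply _)) ?_
  · rw [← Complex.ofReal_eq_zero, ← integral_complex_ofReal, ← this]
    refine integral_congr_ae (ae_of_all _ fun ω => ?_)
    simp only
    rw [mon, ← mul_prod_erase univ _ (mem_univ s)]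
    push_cast
    rfl
  · intro y
    congr 1
    refine prod_congr rfl fun t ht => ?_
    rw [Function.update_of_ne (hs t (mem_erase.1 ht).1)]

theorem IsFamily.integral_mon_sumElim_self (hY : IsFamily μ M Y) (q : ι → A)
    (hq : Function.Injective q) : ∫ ω, mon Y (Sum.elim q q) ω ∂μ = 1 := by
  have h1 := (hY.indep.precomp hq).comp (fun _ x => x ^ 2) fun _ => measurable_id.pow_const 2
  have h2 := h1.integral_fun_prod_eq_prod_integral fun s =>
    ((hY.hasMoments (q s)).1.pow_const 2).aestronglyMeasurable
  have h3 : ∀ ω, mon Y (Sum.elim q q) ω = ∏ s, ((fun x : ℝ => x ^ 2) ∘ Y (q s)) ω := by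
    intro ω
    rw [mon_sumElim, mon, ← prod_mul_distrib]
    exact prod_congr rfl fun s _ => by simp [sq]
  simp only [h3]
  rw [h2]
  exact prod_eq_one fun s _ => by simpa using hY.var (q s)

variable [AddCommGroup A] [Fintype A] [DecidableEq A] [DecidableEq ι]

variable (ι) in
/-- The constant of the moment bound `IsFamily.sum_abs_integral_mon_le`. -/
noncomputable def corankConst (M : ℕ → ℝ) : ℝ := momConst M (Fintype.card ι) * countConst ι

theorem corankConst_nonneg (M : ℕ → ℝ) : 0 ≤ corankConst ι M :=
  mul_nonneg (momConst_nonneg _ _) (Nat.cast_nonneg _)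

/-- Only assignments taking every value at least twice contribute to a sum of expectations of
monomials, so the corank of these assignments controls its size. -/
theorem IsFamily.sum_abs_integral_mon_le [IsAddCyclic A] (hY : IsFamily μ M Y)
    (F : Finset (ι → A)) (e : ℕ) (h : ∀ p ∈ F, (∀ s, ∃ s', s' ≠ s ∧ p s' = p s) → CorankLE p e) :
    ∑ p ∈ F, |∫ ω, mon Y p ω ∂μ| ≤ corankConst ι M * (Fintype.card A : ℝ) ^ e := by
  classical
  rw [← sum_filter_add_sum_filter_not F fun p => ∀ s, ∃ s', s' ≠ s ∧ p s' = p s]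
  have h0 : ∑ p ∈ F with ¬ ∀ s, ∃ s', s' ≠ s ∧ p s' = p s, |∫ ω, mon Y p ω ∂μ| = 0 := by
    refine sum_eq_zero fun p hp => ?_
    have hp := (mem_filter.1 hp).2
    push Not at hp
    obtain ⟨s, hs⟩ := hp
    rw [hY.integral_mon_eq_zero p hs, abs_zero]
  rw [h0, add_zero]
  have hcount := card_le_of_corankLE {p ∈ F | ∀ s, ∃ s', s' ≠ s ∧ p s' = p s} e
    fun p hp => h p (mem_filter.1 hp).1 (mem_filter.1 hp).2
  calc ∑ p ∈ F with ∀ s, ∃ s', s' ≠ s ∧ p s' = p s, |∫ ω, mon Y p ω ∂μ|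
      ≤ ∑ p ∈ F with ∀ s, ∃ s', s' ≠ s ∧ p s' = p s, momConst M (Fintype.card ι) :=
        sum_le_sum fun p _ => hY.abs_integral_mon_le p
    _ = momConst M (Fintype.card ι) * #{p ∈ F | ∀ s, ∃ s', s' ≠ s ∧ p s' = p s} := by
        rw [sum_const, nsmul_eq_mul, mul_comm]
    _ ≤ momConst M (Fintype.card ι) * (countConst ι * Fintype.card A ^ e : ℕ) := by
        gcongr
        exact momConst_nonneg _ _
    _ = _ := by rw [corankConst]; push_cast; ring

/-- The assignments on two copies of the slots that restrict to members of `F` on both. -/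
def double (F : Finset (ι → A)) : Finset (ι ⊕ ι → A) :=
  {q | q ∘ Sum.inl ∈ F ∧ q ∘ Sum.inr ∈ F}

theorem mem_double {F : Finset (ι → A)} {q : ι ⊕ ι → A} :
    q ∈ double F ↔ q ∘ Sum.inl ∈ F ∧ q ∘ Sum.inr ∈ F := by
  simp [double]

theorem sum_comp_inl_comp_inr {R : Type*} [AddCommMonoid R] [DecidableEq κ] (F : Finset (ι → A))
    (G : Finset (κ → A)) (g : (ι → A) → (κ → A) → R) :
    ∑ r : ι ⊕ κ → A with r ∘ Sum.inl ∈ F ∧ r ∘ Sum.inr ∈ G, g (r ∘ Sum.inl) (r ∘ Sum.inr) =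
      ∑ p ∈ F, ∑ q ∈ G, g p q := by
  rw [← sum_product']
  refine sum_bij' (fun r _ => (r ∘ Sum.inl, r ∘ Sum.inr)) (fun x _ => Sum.elim x.1 x.2) ?_ ?_ ?_ ?_
    ?_
  · intro r hr
    simpa using hr
  · rintro ⟨p, q⟩ h
    simpa using h
  · intro r _
    simp
  · rintro ⟨p, q⟩ _
    simp
  · intro r _
    rfl

theorem mon_eq_mul (r : ι ⊕ κ → A) (ω : Ω) :
    mon Y r ω = mon Y (r ∘ Sum.inl) ω * mon Y (r ∘ Sum.inr) ω := by
  rw [← mon_sumElim, Sum.elim_comp_inl_inr]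

theorem sum_mon_mul_sum_mon [DecidableEq κ] (F : Finset (ι → A)) (G : Finset (κ → A)) (ω : Ω) :
    (∑ p ∈ F, mon Y p ω) * ∑ q ∈ G, mon Y q ω =
      ∑ r : ι ⊕ κ → A with r ∘ Sum.inl ∈ F ∧ r ∘ Sum.inr ∈ G, mon Y r ω := by
  simp only [mon_eq_mul (Y := Y) (_ : ι ⊕ κ → A)]
  rw [sum_mul_sum, ← sum_comp_inl_comp_inr]

theorem sum_mon_sq (F : Finset (ι → A)) (ω : Ω) :
    (∑ p ∈ F, mon Y p ω) ^ 2 = ∑ q ∈ double F, mon Y q ω := by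
  rw [sq, sum_mon_mul_sum_mon]
  rfl

theorem IsFamily.integral_sum_mon (hY : IsFamily μ M Y) (F : Finset (ι → A)) :
    ∫ ω, ∑ p ∈ F, mon Y p ω ∂μ = ∑ p ∈ F, ∫ ω, mon Y p ω ∂μ :=
  integral_finsetSum _ fun p _ => (hY.hasMoments_mon p).integrable

theorem IsFamily.hasMoments_sum_mon (hY : IsFamily μ M Y) (F : Finset (ι → A)) :
    HasMoments μ fun ω => ∑ p ∈ F, mon Y p ω :=
  HasMoments.sum _ fun p _ => hY.hasMoments_mon p

theorem IsFamily.integral_sq_le [IsAddCyclic A] (hY : IsFamily μ M Y) (F : Finset (ι → A)) (e : ℕ)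
    (h : ∀ q ∈ double F, (∀ s, ∃ s', s' ≠ s ∧ q s' = q s) → CorankLE q e) :
    ∫ ω, (∑ p ∈ F, mon Y p ω) ^ 2 ∂μ ≤ corankConst (ι ⊕ ι) M * (Fintype.card A : ℝ) ^ e := by
  simp only [sum_mon_sq]
  rw [hY.integral_sum_mon]
  exact (sum_le_sum fun p _ => le_abs_self _).trans (hY.sum_abs_integral_mon_le _ e h)

/-- The second moment bound summed over a family of index sets such that each assignment belongs
to a member only if it takes the corresponding value. -/
theorem IsFamily.sum_sum_abs_integral_mon_le [IsAddCyclic A] (hY : IsFamily μ M Y)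
    (F : A → Finset (ι → A)) (e : ℕ)
    (hF : ∀ a, ∀ p ∈ F a, ∃ s, p s = a)
    (h : ∀ a, ∀ p ∈ F a, (∀ s, ∃ s', s' ≠ s ∧ p s' = p s) → CorankLE p e) :
    ∑ a, ∑ p ∈ F a, |∫ ω, mon Y p ω ∂μ| ≤
      Fintype.card ι * corankConst ι M * (Fintype.card A : ℝ) ^ e := by
  have hsub : ∀ a, F a ⊆ univ.biUnion F := fun a => subset_biUnion_of_mem F (mem_univ a)
  calc ∑ a, ∑ p ∈ F a, |∫ ω, mon Y p ω ∂μ|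
      = ∑ a, ∑ p ∈ univ.biUnion F, if p ∈ F a then |∫ ω, mon Y p ω ∂μ| else 0 := by
        refine sum_congr rfl fun a _ => ?_
        rw [← sum_filter]
        congr 1
        ext p
        simp only [mem_filter]
        exact ⟨fun hp => ⟨hsub a hp, hp⟩, fun hp => hp.2⟩
    _ = ∑ p ∈ univ.biUnion F, #{a | p ∈ F a} * |∫ ω, mon Y p ω ∂μ| := by
        rw [sum_comm]
        refine sum_congr rfl fun p _ => ?_
        rw [← sum_filter, sum_const, nsmul_eq_mul]
    _ ≤ ∑ p ∈ univ.biUnion F, Fintype.card ι * |∫ ω, mon Y p ω ∂μ| := by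
        gcongr with p _
        have : ({a | p ∈ F a} : Finset A) ⊆ univ.image p := by
          intro a ha
          obtain ⟨s, hs⟩ := hF a p (mem_filter.1 ha).2
          exact mem_image.2 ⟨s, mem_univ _, hs⟩
        exact (card_le_card this).trans card_image_le
    _ = Fintype.card ι * ∑ p ∈ univ.biUnion F, |∫ ω, mon Y p ω ∂μ| := by rw [mul_sum]
    _ ≤ Fintype.card ι * (corankConst ι M * (Fintype.card A : ℝ) ^ e) := by
        gcongr
        refine hY.sum_abs_integral_mon_le _ e fun p hp => ?_
        obtain ⟨a, -, ha⟩ := mem_biUnion.1 hp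
        exact h a p ha
    _ = _ := by ring

end Moments

/-! ### Repeated values and second moments -/

section Repetition

variable {A ι : Type*} [DecidableEq A] [Fintype ι] [DecidableEq ι]

theorem two_mul_card_image_le {p : ι → A} (h : ∀ s, ∃ s', s' ≠ s ∧ p s' = p s) :
    2 * #(univ.image p) ≤ Fintype.card ι := by
  have := two_mul_card_image_add_le p ∅ fun s => ?_
  · simpa using this
  · obtain ⟨s', hne, hs'⟩ := h s
    exact ⟨s, s', hne.symm, by simp, by simp, rfl, hs'⟩

/-- The bound `two_mul_card_image_le` improves if one value is taken on `E` and twice more. -/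
theorem two_mul_card_image_add_le_of_common {p : ι → A} (h : ∀ s, ∃ s', s' ≠ s ∧ p s' = p s)
    (E : Finset ι) (v : A) (hE : ∀ t ∈ E, p t = v) {t t' : ι} (hne : t ≠ t') (ht : t ∉ E)
    (ht' : t' ∉ E) (hv : p t = v) (hv' : p t' = v) :
    2 * #(univ.image p) + #E ≤ Fintype.card ι := by
  refine two_mul_card_image_add_le p E fun s => ?_
  by_cases hs : p s = v
  · exact ⟨t, t', hne, ht, ht', hv.trans hs.symm, hv'.trans hs.symm⟩
  · obtain ⟨s', hne, hs'⟩ := h s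
    exact ⟨s, s', hne.symm, fun hm => hs (hE s hm), fun hm => hs (hs' ▸ hE s' hm), rfl, hs'⟩

theorem two_mul_card_image_lt_of_three {p : ι → A} (h : ∀ s, ∃ s', s' ≠ s ∧ p s' = p s)
    {t₁ t₂ t₃ : ι} (h₁₂ : t₁ ≠ t₂) (h₁₃ : t₁ ≠ t₃) (h₂₃ : t₂ ≠ t₃) (h₂ : p t₂ = p t₁)
    (h₃ : p t₃ = p t₁) : 2 * #(univ.image p) < Fintype.card ι := by
  have := two_mul_card_image_add_le_of_common h {t₁} (p t₁) (by simp) h₂₃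
    (by simpa using h₁₂.symm) (by simpa using h₁₃.symm) h₂ h₃
  simpa using this

theorem card_image_map_le {κ : Type*} [Fintype κ] (p : ι → A) (j : κ ↪ ι) :
    #((univ.map j).image p) ≤ Fintype.card κ :=
  card_image_le.trans (by simp)

theorem card_image_lt_of_not_injective {p : ι → A} (h : ¬ Function.Injective p) :
    #(univ.image p) < Fintype.card ι :=
  lt_of_le_of_ne card_image_le fun heq => h (by
    simpa [Set.injOn_univ] using card_image_iff.1 (heq.trans card_univ.symm))

end Repetition

section Estimates

variable {A ι κ : Type*} [AddCommGroup A] [Fintype A] [DecidableEq A]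
  [Fintype ι] [DecidableEq ι] [Fintype κ] [DecidableEq κ]

variable (A ι) in
/-- The assignments of group elements to slots that sum to zero. -/
def zeroSum : Finset (ι → A) := {x | ∑ s, x s = 0}

/-- The zero-sum assignments whose value at the slot `o` is taken at another slot, too. -/
def repeatedAt (A : Type*) [AddCommGroup A] [Fintype A] [DecidableEq A] (o : ι) :
    Finset (ι → A) := {x ∈ zeroSum A ι | ∃ s, s ≠ o ∧ x s = x o}

/-- The zero-sum assignments that take the value `a` exactly at the slot `o`. -/
def onlyAt (o : ι) (a : A) : Finset (ι → A) := {x ∈ zeroSum A ι | x o = a ∧ ∀ s, s ≠ o → x s ≠ a}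

variable (ι) in
/-- The zero-sum assignments that take the value `a`. -/
def through (a : A) : Finset (ι → A) := {x ∈ zeroSum A ι | ∃ s, x s = a}

theorem mem_repeatedAt {o : ι} {x : ι → A} :
    x ∈ repeatedAt A o ↔ x ∈ zeroSum A ι ∧ ∃ s, s ≠ o ∧ x s = x o := by simp [repeatedAt]

theorem mem_onlyAt {o : ι} {a : A} {x : ι → A} :
    x ∈ onlyAt o a ↔ x ∈ zeroSum A ι ∧ x o = a ∧ ∀ s, s ≠ o → x s ≠ a := by simp [onlyAt]

theorem mem_through {a : A} {x : ι → A} :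
    x ∈ through ι a ↔ x ∈ zeroSum A ι ∧ ∃ s, x s = a := by simp [through]

theorem mem_zeroSum {x : ι → A} : x ∈ zeroSum A ι ↔ ∑ s, x s = 0 := by simp [zeroSum]

/-- The fibres of the sum map have equal size. -/
theorem card_zeroSum (o : ι) :
    #(zeroSum A ι) = Fintype.card A ^ (Fintype.card ι - 1) := by
  have hA : 0 < Fintype.card A := Fintype.card_pos_iff.2 ⟨0⟩
  have hfib : ∀ b : A, #{x : ι → A | ∑ s, x s = b} = #(zeroSum A ι) := by
    intro b
    refine card_bij' (fun x _ => x - Pi.single o b) (fun x _ => x + Pi.single o b) ?_ ?_ ?_ ?_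
    · intro x hx
      simp only [mem_filter, mem_univ, true_and] at hx
      simp [mem_zeroSum, hx]
    · intro x hx
      rw [mem_zeroSum] at hx
      simp [sum_add_distrib, hx]
    · intro x _; simp
    · intro x _; simp
  have hsum := card_eq_sum_card_fiberwise (s := (univ : Finset (ι → A)))
    (t := (univ : Finset A)) (f := fun x => ∑ s, x s) (fun _ _ => by simp)
  simp only [hfib, sum_const, smul_eq_mul, card_univ, Fintype.card_fun] at hsum
  have hι : Fintype.card ι - 1 + 1 = Fintype.card ι :=
    Nat.sub_add_cancel (Fintype.card_pos_iff.2 ⟨o⟩)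
  rw [← hι, pow_succ, mul_comm] at hsum
  exact (Nat.eq_of_mul_eq_mul_left hA hsum).symm

variable {Ω : Type*} [MeasurableSpace Ω] {μ : Measure Ω} [IsProbabilityMeasure μ]
  [IsAddCyclic A] {Y : A → Ω → ℝ} {M : ℕ → ℝ}

theorem IsFamily.abs_integral_zeroSum_le (hY : IsFamily μ M Y) (hι : 2 ≤ Fintype.card ι) :
    |∫ ω, ∑ x ∈ zeroSum A ι, mon Y x ω ∂μ| ≤
      corankConst ι M * (Fintype.card A : ℝ) ^ (Fintype.card ι / 2 - 1) := by
  rw [hY.integral_sum_mon]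
  refine (abs_sum_le_sum_abs _ _).trans (hY.sum_abs_integral_mon_le _ _ fun p hp hrep => ?_)
  have h1 := two_mul_card_image_le hrep
  have : Nonempty ι := Fintype.card_pos_iff.1 (by omega)
  exact corankLE_of_one univ_nonempty (mem_zeroSum.1 hp) (by omega)

/-- A repeated value costs half a power of `|A|` compared to all zero-sum assignments. -/
theorem IsFamily.integral_repeatedAt_sq_le (hY : IsFamily μ M Y) (o : ι) (hι : 2 ≤ Fintype.card ι) :
    ∫ ω, (∑ x ∈ repeatedAt A o, mon Y x ω) ^ 2 ∂μ ≤
      corankConst (ι ⊕ ι) M * (Fintype.card A : ℝ) ^ (Fintype.card ι - 2) := by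
  refine hY.integral_sq_le _ _ fun q hq hrep => ?_
  obtain ⟨hl, hr⟩ := mem_double.1 hq
  obtain ⟨hl, s, hs, hso⟩ := mem_filter.1 hl
  obtain ⟨hr, -⟩ := mem_filter.1 hr
  have h1 := two_mul_card_image_le hrep
  rw [Fintype.card_sum] at h1
  have hne : (univ.map Function.Embedding.inl : Finset (ι ⊕ ι)).Nonempty := ⟨Sum.inl o, by simp⟩
  have hl0 : ∑ s ∈ univ.map Function.Embedding.inl, q s = 0 := by
    rw [sum_map]; exact mem_zeroSum.1 hl
  have hr0 : ∑ s ∈ univ.map Function.Embedding.inr, q s = 0 := by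
    rw [sum_map]; exact mem_zeroSum.1 hr
  rcases Nat.lt_or_ge #(univ.image q) (Fintype.card ι) with hlt | hge
  · exact corankLE_of_one hne hl0 (by omega)
  · -- The left copy has a repeated value, so it cannot exhaust the values of `q`.
    have hlt : #((univ.map Function.Embedding.inl).image q) < Fintype.card ι := by
      have := card_image_lt_of_not_injective (p := q ∘ Sum.inl) fun hinj => hs (hinj hso)
      rwa [map_eq_image, image_image]
    obtain ⟨t, ht⟩ := exists_value_notMem q _ (hlt.trans_le hge)
    rcases t with t | t
    · exact absurd rfl (ht (Sum.inl t) (by simp))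
    · exact corankLE_of_two hne hr0 hl0 (s := Sum.inr t) (by simp) ht (by omega)

theorem IsFamily.sum_integral_onlyAt_sq_le (hY : IsFamily μ M Y) (o : ι) :
    ∑ a : A, ∫ ω, (∑ x ∈ onlyAt o a, mon Y x ω) ^ 2 ∂μ ≤
      Fintype.card (ι ⊕ ι) * corankConst (ι ⊕ ι) M *
        (Fintype.card A : ℝ) ^ (Fintype.card ι - 1) := by
  have hι : 0 < Fintype.card ι := Fintype.card_pos_iff.2 ⟨o⟩
  refine le_trans (sum_le_sum fun a _ => ?_)
    (hY.sum_sum_abs_integral_mon_le (fun a => double (onlyAt o a)) _ ?_ ?_)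
  · simp only [sum_mon_sq]
    rw [hY.integral_sum_mon]
    exact sum_le_sum fun p _ => le_abs_self _
  · intro a q hq
    exact ⟨Sum.inl o, (mem_filter.1 (mem_double.1 hq).1).2.1⟩
  · intro a q hq hrep
    have hl := (mem_filter.1 (mem_double.1 hq).1).1
    have h1 := two_mul_card_image_le hrep
    rw [Fintype.card_sum] at h1
    refine corankLE_of_one (B := univ.map Function.Embedding.inl) ⟨Sum.inl o, by simp⟩ ?_ (by omega)
    rw [sum_map]; exact mem_zeroSum.1 hl

theorem IsFamily.sum_integral_through_pow_le (hY : IsFamily μ M Y) (hι : 2 ≤ Fintype.card ι) :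
    ∑ a : A, ∫ ω, (∑ x ∈ through ι a, mon Y x ω) ^ 4 ∂μ ≤
      Fintype.card ((ι ⊕ ι) ⊕ (ι ⊕ ι)) * corankConst ((ι ⊕ ι) ⊕ (ι ⊕ ι)) M *
        (Fintype.card A : ℝ) ^ (2 * Fintype.card ι - 3) := by
  refine le_trans (sum_le_sum fun a _ => ?_)
    (hY.sum_sum_abs_integral_mon_le (fun a => double (double (through ι a))) _ ?_ ?_)
  · have h4 : ∀ ω, (∑ x ∈ through ι a, mon Y x ω) ^ 4 =
        ∑ q ∈ double (double (through ι a)), mon Y q ω := by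
      intro ω
      rw [← sum_mon_sq, ← sum_mon_sq]
      ring
    simp only [h4]
    rw [hY.integral_sum_mon]
    exact sum_le_sum fun p _ => le_abs_self _
  · intro a q hq
    obtain ⟨-, s, hs⟩ := mem_filter.1 (mem_double.1 (mem_double.1 hq).1).1
    exact ⟨Sum.inl (Sum.inl s), hs⟩
  · intro a q hq hrep
    obtain ⟨hL, hR⟩ := mem_double.1 hq
    obtain ⟨h₁, h₂⟩ := mem_double.1 hL
    obtain ⟨h₃, h₄⟩ := mem_double.1 hR
    obtain ⟨h₁, s₁, hs₁⟩ := mem_filter.1 h₁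
    obtain ⟨h₂, s₂, hs₂⟩ := mem_filter.1 h₂
    obtain ⟨h₃, s₃, hs₃⟩ := mem_filter.1 h₃
    obtain ⟨h₄, s₄, hs₄⟩ := mem_filter.1 h₄
    simp only [Function.comp_apply] at hs₁ hs₂ hs₃ hs₄
    have hcard := two_mul_card_image_add_le_of_common hrep
      {Sum.inl (Sum.inl s₁), Sum.inl (Sum.inr s₂)} a (by simp [hs₁, hs₂])
      (t := Sum.inr (Sum.inl s₃)) (t' := Sum.inr (Sum.inr s₄)) (by simp) (by simp) (by simp) hs₃ hs₄
    rw [card_pair (by simp)] at hcard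
    simp only [Fintype.card_sum] at hcard
    let B (j : ι ↪ (ι ⊕ ι) ⊕ (ι ⊕ ι)) : Finset ((ι ⊕ ι) ⊕ (ι ⊕ ι)) := univ.map j
    let j₁ : ι ↪ (ι ⊕ ι) ⊕ (ι ⊕ ι) := Function.Embedding.inl.trans Function.Embedding.inl
    let j₂ : ι ↪ (ι ⊕ ι) ⊕ (ι ⊕ ι) := Function.Embedding.inr.trans Function.Embedding.inl
    let j₃ : ι ↪ (ι ⊕ ι) ⊕ (ι ⊕ ι) := Function.Embedding.inl.trans Function.Embedding.inr
    let j₄ : ι ↪ (ι ⊕ ι) ⊕ (ι ⊕ ι) := Function.Embedding.inr.trans Function.Embedding.inr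
    have z₁ : ∑ s ∈ B j₁, q s = 0 := by simp only [B, sum_map]; exact mem_zeroSum.1 h₁
    have z₂ : ∑ s ∈ B j₂, q s = 0 := by simp only [B, sum_map]; exact mem_zeroSum.1 h₂
    have z₃ : ∑ s ∈ B j₃, q s = 0 := by simp only [B, sum_map]; exact mem_zeroSum.1 h₃
    have z₄ : ∑ s ∈ B j₄, q s = 0 := by simp only [B, sum_map]; exact mem_zeroSum.1 h₄
    have hne : (B j₁).Nonempty := ⟨j₁ s₁, by simp [B]⟩
    rcases Nat.lt_or_ge #(univ.image q) (2 * Fintype.card ι - 1) with hlt | hge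
    · exact corankLE_of_one hne z₁ (by omega)
    · have hB₁ : #((B j₁).image q) < #(univ.image q) :=
        (card_image_map_le q j₁).trans_lt (by omega)
      obtain ⟨t, ht⟩ := exists_value_notMem q _ hB₁
      rcases t with (t | t) | (t | t)
      · exact absurd rfl (ht (j₁ t) (by simp [B]))
      · exact corankLE_of_two hne z₂ z₁ (s := j₂ t) (by simp [B]) ht (by omega)
      · exact corankLE_of_two hne z₃ z₁ (s := j₃ t) (by simp [B]) ht (by omega)
      · exact corankLE_of_two hne z₄ z₁ (s := j₄ t) (by simp [B]) ht (by omega)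

/-- Both halves of the assignment are injective and have the same values. -/
def IsMatched (p : ι ⊕ κ → A) : Prop :=
  Function.Injective (p ∘ Sum.inl) ∧ Function.Injective (p ∘ Sum.inr) ∧
    univ.image (p ∘ Sum.inl) = univ.image (p ∘ Sum.inr)

/-- Unmatched pairs of zero-sum assignments sharing a value are negligible. If all values of two such
pairs are taken exactly twice, then the four zero-sum equations have rank at least three. -/
theorem IsFamily.integral_unmatched_sq_le (hY : IsFamily μ M Y) (hι : 2 ≤ Fintype.card ι)
    (hκ : 2 ≤ Fintype.card κ) (F : Finset (ι ⊕ κ → A))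
    (hl : ∀ p ∈ F, p ∘ Sum.inl ∈ zeroSum A ι) (hr : ∀ p ∈ F, p ∘ Sum.inr ∈ zeroSum A κ)
    (hmeet : ∀ p ∈ F, ∃ s t, p (Sum.inl s) = p (Sum.inr t)) (hF : ∀ p ∈ F, ¬ IsMatched p) :
    ∫ ω, (∑ p ∈ F, mon Y p ω) ^ 2 ∂μ ≤ corankConst ((ι ⊕ κ) ⊕ (ι ⊕ κ)) M *
      (Fintype.card A : ℝ) ^ (Fintype.card ι + Fintype.card κ - 3) := by
  refine hY.integral_sq_le _ _ fun q hq hrep => ?_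
  obtain ⟨hq, hq'⟩ := mem_double.1 hq
  have hcard := two_mul_card_image_le hrep
  simp only [Fintype.card_sum] at hcard
  let j₁ : ι ↪ (ι ⊕ κ) ⊕ (ι ⊕ κ) := Function.Embedding.inl.trans Function.Embedding.inl
  let j₂ : κ ↪ (ι ⊕ κ) ⊕ (ι ⊕ κ) := Function.Embedding.inr.trans Function.Embedding.inl
  let j₃ : ι ↪ (ι ⊕ κ) ⊕ (ι ⊕ κ) := Function.Embedding.inl.trans Function.Embedding.inr
  let j₄ : κ ↪ (ι ⊕ κ) ⊕ (ι ⊕ κ) := Function.Embedding.inr.trans Function.Embedding.inr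
  have z₁ : ∑ s ∈ univ.map j₁, q s = 0 := by rw [sum_map]; exact mem_zeroSum.1 (hl _ hq)
  have z₂ : ∑ s ∈ univ.map j₂, q s = 0 := by rw [sum_map]; exact mem_zeroSum.1 (hr _ hq)
  have z₃ : ∑ s ∈ univ.map j₃, q s = 0 := by rw [sum_map]; exact mem_zeroSum.1 (hl _ hq')
  have z₄ : ∑ s ∈ univ.map j₄, q s = 0 := by rw [sum_map]; exact mem_zeroSum.1 (hr _ hq')
  obtain ⟨a, b, hab⟩ := hmeet _ hq
  have hne₁ : (univ.map j₁).Nonempty := ⟨j₁ a, by simp⟩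
  have hne₂ : (univ.map j₂).Nonempty := ⟨j₂ b, by simp⟩
  rcases Nat.lt_or_ge #(univ.image q) (Fintype.card ι + Fintype.card κ - 1) with hlt | hge
  · exact corankLE_of_one hne₁ z₁ (by omega)
  rcases Nat.lt_or_ge #(univ.image q) (Fintype.card ι + Fintype.card κ) with hlt | hge'
  · have h₁ : #((univ.map j₁).image q) < #(univ.image q) :=
      (card_image_map_le q j₁).trans_lt (by omega)
    obtain ⟨t, ht⟩ := exists_value_notMem q _ h₁
    rcases t with (t | t) | (t | t)
    · exact absurd rfl (ht (j₁ t) (by simp))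
    · exact corankLE_of_two hne₁ z₂ z₁ (s := j₂ t) (by simp) ht (by omega)
    · exact corankLE_of_two hne₁ z₃ z₁ (s := j₃ t) (by simp) ht (by omega)
    · exact corankLE_of_two hne₁ z₄ z₁ (s := j₄ t) (by simp) ht (by omega)
  -- Every value is taken exactly twice, and the first pair of tuples, which share a value, does not
  -- exhaust the values.
  have hL : #((univ.map Function.Embedding.inl).image q) < #(univ.image q) := by
    have : ¬ Function.Injective (q ∘ Sum.inl) := fun hinj => by simpa using hinj hab
    have := card_image_lt_of_not_injective this
    rw [Fintype.card_sum] at this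
    rw [map_eq_image, image_image]
    exact this.trans_le hge'
  obtain ⟨t, ht⟩ := exists_value_notMem q _ hL
  have ht₁ : ∀ u ∈ univ.map j₁, q u ≠ q t := fun u hu => by
    obtain ⟨s, -, rfl⟩ := Finset.mem_map.1 hu
    exact ht _ (by simp [j₁])
  have ht₂ : ∀ u ∈ univ.map j₂, q u ≠ q t := fun u hu => by
    obtain ⟨s, -, rfl⟩ := Finset.mem_map.1 hu
    exact ht _ (by simp [j₂])
  obtain ⟨B, hB, z⟩ : ∃ B : Finset ((ι ⊕ κ) ⊕ (ι ⊕ κ)), t ∈ B ∧ ∑ s ∈ B, q s = 0 := by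
    rcases t with t | (t | t)
    · exact absurd rfl (ht (Sum.inl t) (by simp))
    · exact ⟨_, by simp [j₃], z₃⟩
    · exact ⟨_, by simp [j₄], z₄⟩
  by_cases h₂ : ∃ k, ∀ u ∈ univ.map j₁, q u ≠ q (j₂ k)
  · obtain ⟨k, hk⟩ := h₂
    exact corankLE_of_three hne₁ z z₂ z₁ hB (by simp) ht₂ ht₁ hk (by omega)
  by_cases h₁ : ∃ i, ∀ u ∈ univ.map j₂, q u ≠ q (j₁ i)
  · obtain ⟨i, hi⟩ := h₁
    exact corankLE_of_three hne₂ z z₁ z₂ hB (by simp) ht₁ ht₂ hi (by omega)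
  replace h₁ : ∀ i, ∃ k, q (j₂ k) = q (j₁ i) := fun i => by
    by_contra! h
    refine h₁ ⟨i, fun u hu => ?_⟩
    obtain ⟨k, -, rfl⟩ := Finset.mem_map.1 hu
    exact h k
  replace h₂ : ∀ k, ∃ i, q (j₁ i) = q (j₂ k) := fun k => by
    by_contra! h
    refine h₂ ⟨k, fun u hu => ?_⟩
    obtain ⟨i, -, rfl⟩ := Finset.mem_map.1 hu
    exact h i
  refine absurd ?_ (hF _ hq)
  have hthree : ∀ {t₁ t₂ t₃ : (ι ⊕ κ) ⊕ (ι ⊕ κ)}, t₁ ≠ t₂ → t₁ ≠ t₃ → t₂ ≠ t₃ → q t₂ = q t₁ →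
      q t₃ = q t₁ → False := by
    intro t₁ t₂ t₃ h₁₂ h₁₃ h₂₃ h₂ h₃
    have := two_mul_card_image_lt_of_three hrep h₁₂ h₁₃ h₂₃ h₂ h₃
    simp only [Fintype.card_sum] at this
    omega
  refine ⟨fun s s' hss' => ?_, fun s s' hss' => ?_, ?_⟩
  · by_contra hne
    obtain ⟨k, hk⟩ := h₁ s
    exact hthree (t₁ := j₁ s) (t₂ := j₁ s') (t₃ := j₂ k) (by simpa using hne) (by simp [j₁, j₂])
      (by simp [j₁, j₂]) hss'.symm hk
  · by_contra hne
    obtain ⟨k, hk⟩ := h₂ s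
    exact hthree (t₁ := j₂ s) (t₂ := j₂ s') (t₃ := j₁ k) (by simpa using hne) (by simp [j₁, j₂])
      (by simp [j₁, j₂]) hss'.symm hk
  · ext v
    simp only [mem_image, mem_univ, true_and, Function.comp_apply]
    constructor
    · rintro ⟨s, rfl⟩
      exact h₁ s
    · rintro ⟨k, rfl⟩
      exact h₂ k

end Estimates

/-! ### The overlap of two zero-sum assignments -/

section Overlap

variable {A ι κ : Type*} [AddCommGroup A] [Fintype A] [DecidableEq A]
  [Fintype ι] [DecidableEq ι] [Fintype κ] [DecidableEq κ]
  {Ω : Type*} [MeasurableSpace Ω] {μ : Measure Ω} {Y : A → Ω → ℝ} {M : ℕ → ℝ}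

variable (A κ) in
/-- The pairs of zero-sum assignments, the first of which takes its value at `o` only once, while
the second takes this value, too. -/
def overlap (o : ι) : Finset (ι ⊕ κ → A) :=
  {p | (p ∘ Sum.inl ∈ zeroSum A ι ∧ p ∘ Sum.inr ∈ zeroSum A κ) ∧
    (∀ s, s ≠ o → p (Sum.inl s) ≠ p (Sum.inl o)) ∧ ∃ t, p (Sum.inr t) = p (Sum.inl o)}

theorem mem_overlap {o : ι} {p : ι ⊕ κ → A} : p ∈ overlap A κ o ↔
    (p ∘ Sum.inl ∈ zeroSum A ι ∧ p ∘ Sum.inr ∈ zeroSum A κ) ∧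
      (∀ s, s ≠ o → p (Sum.inl s) ≠ p (Sum.inl o)) ∧ ∃ t, p (Sum.inr t) = p (Sum.inl o) := by
  simp [overlap]

theorem sum_onlyAt_mul_through (o : ι) (ω : Ω) :
    ∑ a : A, (∑ x ∈ onlyAt o a, mon Y x ω) * ∑ x ∈ through κ a, mon Y x ω =
      ∑ p ∈ overlap A κ o, mon Y p ω := by
  rw [← sum_fiberwise (overlap A κ o) (fun p => p (Sum.inl o))]
  refine sum_congr rfl fun a _ => ?_
  rw [sum_mon_mul_sum_mon]
  congr 1
  ext p
  simp only [mem_filter, mem_univ, true_and, mem_overlap, onlyAt, through, Function.comp_apply]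
  constructor
  · rintro ⟨⟨h1, rfl, h2⟩, h3, h4⟩
    exact ⟨⟨⟨h1, h3⟩, h2, h4⟩, rfl⟩
  · rintro ⟨⟨⟨h1, h3⟩, h2, h4⟩, rfl⟩
    exact ⟨⟨h1, rfl, h2⟩, h3, h4⟩

variable (A ι) in
/-- The injective zero-sum assignments. -/
def injZeroSum : Finset (ι → A) := {x ∈ zeroSum A ι | Function.Injective x}

/-- A matched pair consists of an injective assignment and one of its `(card ι)!` permutations. -/
theorem sum_matched (o : ι) (ω : Ω) [DecidablePred (IsMatched (A := A) (ι := ι) (κ := ι))] :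
    ∑ p ∈ overlap A ι o with IsMatched p, mon Y p ω =
      (Fintype.card ι).factorial * ∑ x ∈ injZeroSum A ι, mon Y (Sum.elim x x) ω := by
  have h1 : ∑ y ∈ injZeroSum A ι ×ˢ (univ : Finset (Equiv.Perm ι)), mon Y (Sum.elim y.1 y.1) ω =
      (Fintype.card ι).factorial * ∑ x ∈ injZeroSum A ι, mon Y (Sum.elim x x) ω := by
    rw [sum_product_right]
    simp [Fintype.card_perm]
  rw [← h1]
  symm
  refine sum_bij (fun y _ => Sum.elim y.1 (y.1 ∘ y.2)) ?_ ?_ ?_ ?_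
  · rintro ⟨x, σ⟩ h
    obtain ⟨hx, hinj⟩ := mem_filter.1 (mem_product.1 h).1
    rw [mem_zeroSum] at hx
    refine mem_filter.2 ⟨mem_overlap.2 ⟨⟨mem_zeroSum.2 hx, mem_zeroSum.2 ?_⟩, fun s hs => hinj.ne hs,
      σ.symm o, by simp⟩, hinj, hinj.comp σ.injective, ?_⟩
    · exact (Equiv.sum_comp σ x).trans hx
    · ext v
      simp only [mem_image, mem_univ, true_and, Function.comp_apply, Sum.elim_inl, Sum.elim_inr]
      exact ⟨fun ⟨s, hs⟩ => ⟨σ.symm s, by simpa using hs⟩, fun ⟨s, hs⟩ => ⟨σ s, hs⟩⟩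
  · rintro ⟨x, σ⟩ h ⟨x', σ'⟩ - heq
    have hinj := (mem_filter.1 (mem_product.1 h).1).2
    obtain rfl : x = x' := funext fun s => congrFun heq (Sum.inl s)
    have : σ = σ' := Equiv.ext fun s => hinj (congrFun heq (Sum.inr s))
    rw [this]
  · intro p hp
    obtain ⟨hp, hl, hr, himg⟩ := mem_filter.1 hp
    obtain ⟨⟨hz, -⟩, -⟩ := mem_overlap.1 hp
    have hex : ∀ t, ∃ s, p (Sum.inl s) = p (Sum.inr t) := by
      intro t
      have : p (Sum.inr t) ∈ univ.image (p ∘ Sum.inl) := himg ▸ mem_image.2 ⟨t, by simp⟩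
      simpa using this
    choose σ hσ using hex
    have hσinj : Function.Injective σ := fun t t' h => hr (by
      simp only [Function.comp_apply]
      rw [← hσ, ← hσ, h])
    refine ⟨(p ∘ Sum.inl, Equiv.ofBijective σ (Finite.injective_iff_bijective.1 hσinj)), ?_, ?_⟩
    · simp [injZeroSum, hz, hl]
    · funext s
      rcases s with s | s
      · simp
      · simp [hσ]
  · rintro ⟨x, σ⟩ -
    rw [mon_sumElim, mon_sumElim]
    congr 1
    exact (Equiv.prod_comp σ fun s => Y (x s) ω).symm

variable [IsProbabilityMeasure μ] [IsAddCyclic A]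

theorem card_zeroSum_sub_le (hι : 2 ≤ Fintype.card ι) :
    Fintype.card A ^ (Fintype.card ι - 1) ≤
      #(injZeroSum A ι) + countConst ι * Fintype.card A ^ (Fintype.card ι - 2) := by
  have hne : Nonempty ι := Fintype.card_pos_iff.1 (by omega)
  classical
  rw [← card_zeroSum (A := A) hne.some,
    ← card_filter_add_card_filter_not (s := zeroSum A ι) Function.Injective]
  refine Nat.add_le_add_left (card_le_of_corankLE _ _ fun p hp => ?_) _
  obtain ⟨hp, hinj⟩ := mem_filter.1 hp
  have := card_image_lt_of_not_injective hinj
  exact corankLE_of_one univ_nonempty (mem_zeroSum.1 hp) (by omega)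

theorem card_double_not_injective_le (hι : 2 ≤ Fintype.card ι) :
    #{q ∈ double (injZeroSum A ι) | ¬ Function.Injective q} ≤
      countConst (ι ⊕ ι) * Fintype.card A ^ (2 * Fintype.card ι - 3) := by
  have hne : Nonempty ι := Fintype.card_pos_iff.1 (by omega)
  refine card_le_of_corankLE _ _ fun q hq => ?_
  obtain ⟨hq, hinj⟩ := mem_filter.1 hq
  obtain ⟨hl, hr⟩ := mem_double.1 hq
  have hcard := card_image_lt_of_not_injective hinj
  rw [Fintype.card_sum] at hcard
  have z₁ : ∑ s ∈ univ.map Function.Embedding.inl, q s = 0 := by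
    rw [sum_map]; exact mem_zeroSum.1 (mem_filter.1 hl).1
  have z₂ : ∑ s ∈ univ.map Function.Embedding.inr, q s = 0 := by
    rw [sum_map]; exact mem_zeroSum.1 (mem_filter.1 hr).1
  have hne₁ : (univ.map Function.Embedding.inl : Finset (ι ⊕ ι)).Nonempty :=
    ⟨Sum.inl hne.some, by simp⟩
  rcases Nat.lt_or_ge #(univ.image q) (2 * Fintype.card ι - 1) with hlt | hge
  · exact corankLE_of_one hne₁ z₁ (by omega)
  · obtain ⟨t, ht⟩ := exists_value_notMem q (univ.map Function.Embedding.inl)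
      ((card_image_map_le q _).trans_lt (by omega))
    rcases t with t | t
    · exact absurd rfl (ht (Sum.inl t) (by simp))
    · exact corankLE_of_two hne₁ z₂ z₁ (s := Sum.inr t) (by simp) ht (by omega)

variable (ι) in
/-- The constant of the bound `IsFamily.integral_injZeroSum_sub_sq_le`. -/
noncomputable def squareConst (M : ℕ → ℝ) : ℝ :=
  momConst M (Fintype.card ((ι ⊕ ι) ⊕ (ι ⊕ ι))) * countConst (ι ⊕ ι) + 2 * countConst ι

/-- A law of large numbers: the sum of `∏ s, Y (x s) ^ 2` over injective zero-sum assignments `x`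
concentrates around the number of zero-sum assignments. -/
theorem IsFamily.integral_injZeroSum_sub_sq_le (hY : IsFamily μ M Y) (hι : 2 ≤ Fintype.card ι) :
    ∫ ω, (∑ x ∈ injZeroSum A ι, mon Y (Sum.elim x x) ω -
        (Fintype.card A : ℝ) ^ (Fintype.card ι - 1)) ^ 2 ∂μ ≤
      squareConst ι M * (Fintype.card A : ℝ) ^ (2 * Fintype.card ι - 3) := by
  have hne : Nonempty ι := Fintype.card_pos_iff.1 (by omega)
  set n : ℝ := (Fintype.card A : ℝ) with hn
  have hn0 : 0 ≤ n := Nat.cast_nonneg _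
  set Z : Ω → ℝ := fun ω => ∑ x ∈ injZeroSum A ι, mon Y (Sum.elim x x) ω
  have hZ : HasMoments μ Z := HasMoments.sum _ fun x _ => hY.hasMoments_mon _
  have hEZ : ∫ ω, Z ω ∂μ = #(injZeroSum A ι) := by
    simp only [Z]
    rw [integral_finsetSum _ fun x _ => (hY.hasMoments_mon _).integrable]
    refine (sum_congr rfl fun x hx =>
      hY.integral_mon_sumElim_self x (mem_filter.1 hx).2).trans ?_
    simp [injZeroSum]
  have hZsq : ∀ ω, Z ω ^ 2 = ∑ q ∈ double (injZeroSum A ι), mon Y (Sum.elim q q) ω := by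
    intro ω
    have := sum_comp_inl_comp_inr (injZeroSum A ι) (injZeroSum A ι)
      fun x y => mon Y (Sum.elim x x) ω * mon Y (Sum.elim y y) ω
    rw [sq, sum_mul_sum, ← this]
    refine sum_congr rfl fun q _ => ?_
    rw [mon_sumElim, mon_sumElim, mon_sumElim, mon_eq_mul q]
    ring
  have hdouble : (#(double (injZeroSum A ι)) : ℝ) ≤ n ^ (Fintype.card ι - 1) *
      n ^ (Fintype.card ι - 1) := by
    have h1 : #(double (injZeroSum A ι)) = #(injZeroSum A ι) * #(injZeroSum A ι) := by
      have := sum_comp_inl_comp_inr (injZeroSum A ι) (injZeroSum A ι) fun _ _ => 1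
      simp only [sum_const, smul_eq_mul, mul_one] at this
      exact this
    have h2 : #(injZeroSum A ι) ≤ Fintype.card A ^ (Fintype.card ι - 1) :=
      (card_filter_le _ _).trans_eq (card_zeroSum hne.some)
    have h3 : #(double (injZeroSum A ι)) ≤ Fintype.card A ^ (Fintype.card ι - 1) *
        Fintype.card A ^ (Fintype.card ι - 1) := h1.trans_le (Nat.mul_le_mul h2 h2)
    rw [hn]
    exact_mod_cast h3
  have hEZ2 : ∫ ω, Z ω ^ 2 ∂μ ≤ n ^ (Fintype.card ι - 1) * n ^ (Fintype.card ι - 1) +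
      momConst M (Fintype.card ((ι ⊕ ι) ⊕ (ι ⊕ ι))) *
        (countConst (ι ⊕ ι) * n ^ (2 * Fintype.card ι - 3)) := by
    classical
    simp only [hZsq]
    rw [integral_finsetSum _ fun x _ => (hY.hasMoments_mon _).integrable,
      ← sum_filter_add_sum_filter_not _ Function.Injective]
    refine add_le_add ?_ ?_
    · rw [sum_congr rfl fun q hq => hY.integral_mon_sumElim_self q (mem_filter.1 hq).2]
      refine le_trans ?_ hdouble
      rw [sum_const, nsmul_eq_mul, mul_one]
      exact_mod_cast card_filter_le _ _
    · refine (sum_le_sum fun q _ =>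
        (le_abs_self _).trans (hY.abs_integral_mon_le (Sum.elim q q))).trans ?_
      rw [sum_const, nsmul_eq_mul, mul_comm]
      refine mul_le_mul_of_nonneg_left ?_ (momConst_nonneg _ _)
      have := card_double_not_injective_le (A := A) hι
      rw [hn]
      exact_mod_cast this
  have hlow : n ^ (Fintype.card ι - 1) ≤
      #(injZeroSum A ι) + countConst ι * n ^ (Fintype.card ι - 2) := by
    rw [hn]
    exact_mod_cast card_zeroSum_sub_le (A := A) hι
  have hexp : ∫ ω, (Z ω - n ^ (Fintype.card ι - 1)) ^ 2 ∂μ =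
      ∫ ω, Z ω ^ 2 ∂μ - 2 * n ^ (Fintype.card ι - 1) * ∫ ω, Z ω ∂μ +
        (n ^ (Fintype.card ι - 1)) ^ 2 := by
    have : ∀ ω, (Z ω - n ^ (Fintype.card ι - 1)) ^ 2 =
        (Z ω ^ 2 - 2 * n ^ (Fintype.card ι - 1) * Z ω) + (n ^ (Fintype.card ι - 1)) ^ 2 :=
      fun ω => by ring
    simp only [this]
    have hi : Integrable (fun ω => Z ω ^ 2 - 2 * n ^ (Fintype.card ι - 1) * Z ω) μ :=
      (hZ.integrable_pow 2).sub (hZ.integrable.const_mul _)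
    rw [integral_add hi (integrable_const _),
      integral_sub (hZ.integrable_pow 2) (hZ.integrable.const_mul _), integral_const_mul]
    simp
  rw [hexp, hEZ, squareConst]
  have hpow : n ^ (2 * Fintype.card ι - 3) =
      n ^ (Fintype.card ι - 1) * n ^ (Fintype.card ι - 2) := by
    rw [← pow_add]; congr 1; omega
  rw [hpow] at hEZ2 ⊢
  have h5 := mul_le_mul_of_nonneg_left hlow (pow_nonneg hn0 (Fintype.card ι - 1))
  linarith

/-- Overlapping assignments to different numbers of slots are never matched. -/
theorem IsFamily.integral_overlap_sq_le (hY : IsFamily μ M Y) (hι : 2 ≤ Fintype.card ι)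
    (hκ : 2 ≤ Fintype.card κ) (hne : Fintype.card ι ≠ Fintype.card κ) (o : ι) :
    ∫ ω, (∑ p ∈ overlap A κ o, mon Y p ω) ^ 2 ∂μ ≤ corankConst ((ι ⊕ κ) ⊕ (ι ⊕ κ)) M *
      (Fintype.card A : ℝ) ^ (Fintype.card ι + Fintype.card κ - 3) := by
  refine hY.integral_unmatched_sq_le hι hκ _ (fun p hp => (mem_overlap.1 hp).1.1)
    (fun p hp => (mem_overlap.1 hp).1.2) (fun p hp => ?_) fun p _ hm => hne ?_
  · obtain ⟨-, -, t, ht⟩ := mem_overlap.1 hp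
    exact ⟨o, t, ht.symm⟩
  · obtain ⟨h1, h2, h3⟩ := hm
    rw [← card_univ, ← card_univ, ← card_image_of_injective univ h1, h3,
      card_image_of_injective univ h2]

/-- The overlap sum splits into matched pairs, which concentrate, and negligible unmatched ones. -/
theorem IsFamily.integral_overlap_sub_sq_le (hY : IsFamily μ M Y) (hι : 2 ≤ Fintype.card ι)
    (o : ι) :
    ∫ ω, (∑ p ∈ overlap A ι o, mon Y p ω -
        (Fintype.card ι).factorial * (Fintype.card A : ℝ) ^ (Fintype.card ι - 1)) ^ 2 ∂μ ≤
      2 * (((Fintype.card ι).factorial : ℝ) ^ 2 * squareConst ι M +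
        corankConst ((ι ⊕ ι) ⊕ (ι ⊕ ι)) M) *
          (Fintype.card A : ℝ) ^ (2 * Fintype.card ι - 3) := by
  classical
  set f : ℝ := ((Fintype.card ι).factorial : ℝ)
  set n : ℝ := (Fintype.card A : ℝ) with hn
  set U : Ω → ℝ := fun ω => ∑ p ∈ overlap A ι o with ¬ IsMatched p, mon Y p ω
  set Z : Ω → ℝ := fun ω => ∑ x ∈ injZeroSum A ι, mon Y (Sum.elim x x) ω - n ^ (Fintype.card ι - 1)
  have hU : HasMoments μ U := hY.hasMoments_sum_mon _
  have hZ : HasMoments μ Z :=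
    (HasMoments.sum _ fun x _ => hY.hasMoments_mon _).sub (HasMoments.const _)
  have hdecomp : ∀ ω, ∑ p ∈ overlap A ι o, mon Y p ω - f * n ^ (Fintype.card ι - 1) =
      f * Z ω + U ω := by
    intro ω
    rw [← sum_filter_add_sum_filter_not _ IsMatched, sum_matched]
    simp only [Z, U, f]
    ring
  have hU2 : ∫ ω, U ω ^ 2 ∂μ ≤ corankConst ((ι ⊕ ι) ⊕ (ι ⊕ ι)) M *
      n ^ (2 * Fintype.card ι - 3) := by
    rw [two_mul]
    refine hY.integral_unmatched_sq_le hι hι _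
      (fun p hp => (mem_overlap.1 (mem_filter.1 hp).1).1.1)
      (fun p hp => (mem_overlap.1 (mem_filter.1 hp).1).1.2) (fun p hp => ?_)
      fun p hp => (mem_filter.1 hp).2
    obtain ⟨-, -, t, ht⟩ := mem_overlap.1 (mem_filter.1 hp).1
    exact ⟨o, t, ht.symm⟩
  have hZ2 : ∫ ω, Z ω ^ 2 ∂μ ≤ squareConst ι M * n ^ (2 * Fintype.card ι - 3) :=
    hY.integral_injZeroSum_sub_sq_le hι
  simp only [hdecomp]
  calc ∫ ω, (f * Z ω + U ω) ^ 2 ∂μ ≤ ∫ ω, (2 * f ^ 2 * Z ω ^ 2 + 2 * U ω ^ 2) ∂μ := by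
        refine integral_mono (((hZ.const_mul f).add hU).integrable_pow 2)
          (((hZ.integrable_pow 2).const_mul _).add ((hU.integrable_pow 2).const_mul _)) fun ω => ?_
        simp only
        nlinarith [sq_nonneg (f * Z ω - U ω)]
    _ = 2 * f ^ 2 * ∫ ω, Z ω ^ 2 ∂μ + 2 * ∫ ω, U ω ^ 2 ∂μ := by
        rw [integral_add ((hZ.integrable_pow 2).const_mul _) ((hU.integrable_pow 2).const_mul _),
          integral_const_mul, integral_const_mul]
    _ ≤ 2 * f ^ 2 * (squareConst ι M * n ^ (2 * Fintype.card ι - 3)) +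
          2 * (corankConst ((ι ⊕ ι) ⊕ (ι ⊕ ι)) M * n ^ (2 * Fintype.card ι - 3)) := by
        gcongr
    _ = _ := by ring

end Overlap

/-! ### Stein's method with a leave-one-out coupling -/

section Stein

variable {Ω : Type*} [MeasurableSpace Ω] {μ : Measure Ω} [IsProbabilityMeasure μ]

theorem norm_one_sub_exp_sub_le (x : ℝ) :
    ‖1 - Complex.exp (-(x * Complex.I)) - x * Complex.I‖ ≤ 3 * x ^ 2 := by
  have hn : ‖-((x : ℂ) * Complex.I)‖ = |x| := by simp
  have hrw : 1 - Complex.exp (-(x * Complex.I)) - x * Complex.I =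
      -(Complex.exp (-(x * Complex.I)) - 1 - -(x * Complex.I)) := by ring
  rw [hrw, norm_neg]
  rcases le_or_gt |x| 1 with h | h
  · have := Complex.norm_exp_sub_one_sub_id_le (hn.trans_le h)
    rw [hn, sq_abs] at this
    linarith [sq_nonneg x]
  · have he : ‖Complex.exp (-((x : ℂ) * Complex.I))‖ = 1 := by
      have := Complex.norm_exp_ofReal_mul_I (-x)
      simpa using this
    calc ‖Complex.exp (-(x * Complex.I)) - 1 - -(x * Complex.I)‖
        ≤ ‖Complex.exp (-(x * Complex.I))‖ + ‖(1 : ℂ)‖ + ‖-((x : ℂ) * Complex.I)‖ :=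
          (norm_sub_le _ _).trans (add_le_add_left (norm_sub_le _ _) _)
      _ = 2 + |x| := by rw [he, hn, norm_one]; ring
      _ ≤ 3 * x ^ 2 := by rw [← sq_abs]; nlinarith

theorem HasMoments.integrable_mul_exp {f g : Ω → ℝ} (hf : HasMoments μ f) (hg : HasMoments μ g)
    (t : ℝ) : Integrable (fun ω => (f ω : ℂ) * Complex.exp ((t * g ω : ℝ) * Complex.I)) μ := by
  refine hf.abs.integrable.mono' ?_ (ae_of_all _ fun ω => ?_)
  · refine ((Complex.measurable_ofReal.comp hf.1).mul (Complex.measurable_exp.comp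
      ((Complex.measurable_ofReal.comp (hg.1.const_mul t)).mul_const _))).aestronglyMeasurable
  · rw [norm_mul, Complex.norm_exp_ofReal_mul_I, mul_one]
    simp

/-- Stein's method with a leave-one-out coupling: `T - Δ a` is a perturbation of `T` which is
orthogonal to the summand `V a` of `T`, and `∑ a, V a * Δ a` is close to the constant `v`. Then the
characteristic function `φ` of `T` nearly satisfies the equation `φ' = - v t φ`. -/
theorem norm_integral_mul_exp_sub_le {A : Type*} [Fintype A] {T R : Ω → ℝ} {V Δ : A → Ω → ℝ}
    (hT : HasMoments μ T) (hR : HasMoments μ R) (hV : ∀ a, HasMoments μ (V a))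
    (hΔ : ∀ a, HasMoments μ (Δ a)) (hsum : ∀ ω, T ω = R ω + ∑ a, V a ω) (t v : ℝ)
    (horth : ∀ a, ∫ ω, (V a ω : ℂ) *
      Complex.exp ((t * (T ω - Δ a ω) : ℝ) * Complex.I) ∂μ = 0) :
    ‖∫ ω, (T ω : ℂ) * Complex.exp ((t * T ω : ℝ) * Complex.I) ∂μ -
        v * t * Complex.I * ∫ ω, Complex.exp ((t * T ω : ℝ) * Complex.I) ∂μ‖ ≤
      ∫ ω, |R ω| ∂μ + |t| * ∫ ω, |∑ a, V a ω * Δ a ω - v| ∂μ +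
        3 * t ^ 2 * ∑ a, ∫ ω, |V a ω| * Δ a ω ^ 2 ∂μ := by
  set E : Ω → ℂ := fun ω => Complex.exp ((t * T ω : ℝ) * Complex.I) with hE
  set G : A → Ω → ℂ := fun a ω => (V a ω : ℂ) *
      Complex.exp ((t * (T ω - Δ a ω) : ℝ) * Complex.I) with hG
  have hGint : ∀ a, Integrable (G a) μ := fun a => (hV a).integrable_mul_exp (hT.sub (hΔ a)) t
  have hTE : Integrable (fun ω => (T ω : ℂ) * E ω) μ := hT.integrable_mul_exp hT t
  have hEint : Integrable E μ := by
    simpa [hE] using (HasMoments.const (μ := μ) 1).integrable_mul_exp hT t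
  have hΓ : HasMoments μ fun ω => ∑ a, V a ω * Δ a ω - v :=
    (HasMoments.sum _ fun a _ => (hV a).mul (hΔ a)).sub (HasMoments.const v)
  have hVD : ∀ a, HasMoments μ fun ω => |V a ω| * Δ a ω ^ 2 :=
    fun a => (hV a).abs.mul ((hΔ a).pow 2)
  have hI1 : Integrable (fun ω => (T ω : ℂ) * E ω - v * t * Complex.I * E ω) μ :=
    hTE.sub (hEint.const_mul _)
  have hlhs : ∫ ω, (T ω : ℂ) * E ω ∂μ - v * t * Complex.I * ∫ ω, E ω ∂μ =
      ∫ ω, ((T ω : ℂ) * E ω - v * t * Complex.I * E ω - ∑ a, G a ω) ∂μ := by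
    rw [integral_sub hI1 (integrable_finsetSum _ fun a _ => hGint a),
      integral_sub hTE (hEint.const_mul _), integral_const_mul,
      integral_finsetSum _ fun a _ => hGint a, sum_eq_zero fun a _ => horth a, sub_zero]
  have hrhs : ∫ ω, (|R ω| + |t| * |∑ a, V a ω * Δ a ω - v| +
      3 * t ^ 2 * ∑ a, |V a ω| * Δ a ω ^ 2) ∂μ = ∫ ω, |R ω| ∂μ +
        |t| * ∫ ω, |∑ a, V a ω * Δ a ω - v| ∂μ +
        3 * t ^ 2 * ∑ a, ∫ ω, |V a ω| * Δ a ω ^ 2 ∂μ := by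
    have h12 := hR.abs.add (hΓ.abs.const_mul |t|)
    rw [integral_add h12.integrable
      ((HasMoments.sum _ fun a _ => hVD a).const_mul (3 * t ^ 2)).integrable,
      integral_add hR.abs.integrable (hΓ.abs.const_mul |t|).integrable, integral_const_mul,
      integral_const_mul, integral_finsetSum _ fun a _ => (hVD a).integrable]
  rw [hlhs, ← hrhs]
  refine norm_integral_le_of_norm_le ((hR.abs.add (hΓ.abs.const_mul |t|)).add
    ((HasMoments.sum _ fun a _ => hVD a).const_mul (3 * t ^ 2))).integrable (ae_of_all _ fun ω => ?_)
  have hEn : ‖E ω‖ = 1 := Complex.norm_exp_ofReal_mul_I _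
  have hGE : ∀ a, G a ω = V a ω * E ω * Complex.exp (-((t * Δ a ω : ℝ) * Complex.I)) := by
    intro a
    simp only [hG, hE]
    rw [mul_assoc, ← Complex.exp_add]
    congr 2
    push_cast
    ring
  set ρ : A → ℂ := fun a =>
    1 - Complex.exp (-((t * Δ a ω : ℝ) * Complex.I)) - (t * Δ a ω : ℝ) * Complex.I with hρ
  have hid : (T ω : ℂ) * E ω - v * t * Complex.I * E ω - ∑ a, G a ω =
      R ω * E ω + t * Complex.I * ((∑ a, V a ω * Δ a ω - v : ℝ) : ℂ) * E ω +
        ∑ a, V a ω * E ω * ρ a := by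
    have h1 : ∑ a, V a ω * E ω * ρ a =
        (∑ a, (V a ω : ℂ)) * E ω - ∑ a, G a ω - t * Complex.I * (∑ a, (V a ω : ℂ) * Δ a ω) * E ω := by
      rw [sum_mul, mul_sum, sum_mul, ← sum_sub_distrib, ← sum_sub_distrib]
      refine sum_congr rfl fun a _ => ?_
      rw [hGE a, hρ]
      push_cast
      ring
    rw [h1, hsum ω]
    push_cast
    ring
  rw [hid]
  refine (norm_add_le _ _).trans (add_le_add ((norm_add_le _ _).trans (add_le_add ?_ ?_)) ?_)
  · rw [norm_mul, hEn, mul_one]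
    simp
  · rw [norm_mul, norm_mul, norm_mul, hEn, Complex.norm_I, Complex.norm_real, Complex.norm_real]
    simp
  · rw [mul_sum]
    refine (norm_sum_le _ _).trans (sum_le_sum fun a _ => ?_)
    rw [norm_mul, norm_mul, hEn, Complex.norm_real, Real.norm_eq_abs, mul_one]
    have := norm_one_sub_exp_sub_le (t * Δ a ω)
    calc |V a ω| * ‖ρ a‖ ≤ |V a ω| * (3 * (t * Δ a ω) ^ 2) := by gcongr
      _ = _ := by ring

/-- An `L¹` bound from an `L²` bound, by `|f| ≤ s⁻¹ + s f ^ 2`. -/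
theorem HasMoments.integral_abs_le {f : Ω → ℝ} (hf : HasMoments μ f) {K s : ℝ} (hs : 0 < s)
    (h : ∫ ω, f ω ^ 2 ∂μ ≤ K / s ^ 2) : ∫ ω, |f ω| ∂μ ≤ (1 + K) / s := by
  calc ∫ ω, |f ω| ∂μ ≤ ∫ ω, (1 / s + s * f ω ^ 2) ∂μ := by
        refine integral_mono hf.abs.integrable
          ((integrable_const _).add ((hf.integrable_pow 2).const_mul s)) fun ω => ?_
        simp only
        have h1 : 1 / s + s * f ω ^ 2 - |f ω| = (1 + (1 - 2 * (s * |f ω|)) ^ 2 + 2) / (4 * s) := by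
          rw [← sq_abs (f ω)]
          field_simp
          ring
        have h2 : 0 ≤ (1 + (1 - 2 * (s * |f ω|)) ^ 2 + 2) / (4 * s) := by positivity
        linarith
    _ = 1 / s + s * ∫ ω, f ω ^ 2 ∂μ := by
        rw [integral_add (integrable_const _) ((hf.integrable_pow 2).const_mul s),
          integral_const_mul]
        simp
    _ ≤ 1 / s + s * (K / s ^ 2) := by gcongr
    _ = _ := by field_simp

theorem integral_abs_sum_le {α : Type*} (S : Finset α) {f : α → Ω → ℝ}
    (hf : ∀ a ∈ S, HasMoments μ (f a)) :
    ∫ ω, |∑ a ∈ S, f a ω| ∂μ ≤ ∑ a ∈ S, ∫ ω, |f a ω| ∂μ := by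
  rw [← integral_finsetSum _ fun a ha => (hf a ha).abs.integrable]
  exact integral_mono (HasMoments.sum S hf).abs.integrable
    (HasMoments.sum S fun a ha => (hf a ha).abs).integrable fun ω => abs_sum_le_sum_abs _ _

end Stein

/-! ### Decomposition of the statistic -/

section Statistic

variable {Ω : Type*} [MeasurableSpace Ω] {μ : Measure Ω} [IsProbabilityMeasure μ]
  {A : Type*} [AddCommGroup A] [Fintype A] [DecidableEq A] {Y : A → Ω → ℝ} {M : ℕ → ℝ}

/-- The linear combination with coefficients `b k` of the monomial sums over given sets of
assignments to `k + 2` slots, where `k < D`. -/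
def combo (Y : A → Ω → ℝ) (b : ℕ → ℝ) (D : ℕ) (F : ∀ k : ℕ, Finset (Fin (k + 2) → A)) (ω : Ω) : ℝ :=
  ∑ k ∈ range D, b k * ∑ x ∈ F k, mon Y x ω

theorem IsFamily.hasMoments_combo (hY : IsFamily μ M Y) (b : ℕ → ℝ) (D : ℕ)
    (F : ∀ k : ℕ, Finset (Fin (k + 2) → A)) : HasMoments μ (combo Y b D F) :=
  HasMoments.sum _ fun k _ => (hY.hasMoments_sum_mon (F k)).const_mul (b k)

theorem combo_zeroSum (b : ℕ → ℝ) (D : ℕ) (ω : Ω) :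
    combo Y b D (fun k => zeroSum A (Fin (k + 2))) ω =
      combo Y b D (fun k => repeatedAt A (0 : Fin (k + 2))) ω +
        ∑ a : A, combo Y b D (fun k => onlyAt (0 : Fin (k + 2)) a) ω := by
  simp only [combo]
  rw [sum_comm, ← sum_add_distrib]
  refine sum_congr rfl fun k _ => ?_
  rw [← mul_sum, ← mul_add]
  congr 1
  rw [← sum_filter_add_sum_filter_not (zeroSum A (Fin (k + 2))) fun x => ∃ s, s ≠ 0 ∧ x s = x 0]
  congr 1
  · congr 1
    ext x
    simp only [mem_filter, mem_repeatedAt]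
  rw [← sum_fiberwise ({x ∈ zeroSum A (Fin (k + 2)) | ¬ ∃ s, s ≠ 0 ∧ x s = x 0})
    (fun x : Fin (k + 2) → A => x 0) (fun x => mon Y x ω)]
  refine sum_congr rfl fun a _ => ?_
  congr 1
  ext x
  simp only [mem_filter, mem_onlyAt]
  push Not
  constructor
  · rintro ⟨⟨h1, h2⟩, rfl⟩
    exact ⟨h1, rfl, h2⟩
  · rintro ⟨h1, rfl, h2⟩
    exact ⟨⟨h1, h2⟩, rfl⟩

theorem combo_zeroSum_sub_through (b : ℕ → ℝ) (D : ℕ) (a : A) (ω : Ω) :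
    combo Y b D (fun k => zeroSum A (Fin (k + 2))) ω -
        combo Y b D (fun k => through (Fin (k + 2)) a) ω =
      combo Y b D (fun k => {x ∈ zeroSum A (Fin (k + 2)) | ¬ ∃ s, x s = a}) ω := by
  simp only [combo]
  rw [← sum_sub_distrib]
  refine sum_congr rfl fun k _ => ?_
  rw [← sum_filter_add_sum_filter_not (zeroSum A (Fin (k + 2))) fun x => ∃ s, x s = a]
  have : through (Fin (k + 2)) a = {x ∈ zeroSum A (Fin (k + 2)) | ∃ s, x s = a} := by
    ext x
    simp only [mem_filter, mem_through]
  rw [this]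
  ring

/-- The terms containing `Y a` exactly once, at the slot `0`, are orthogonal to every bounded
function of the terms not containing `Y a`. -/
theorem IsFamily.integral_onlyAt_mul_exp_eq_zero (hY : IsFamily μ M Y) (b : ℕ → ℝ) (D : ℕ) (t : ℝ)
    (a : A) :
    ∫ ω, (combo Y b D (fun k => onlyAt (0 : Fin (k + 2)) a) ω : ℂ) *
      Complex.exp ((t * (combo Y b D (fun k => zeroSum A (Fin (k + 2))) ω -
        combo Y b D (fun k => through (Fin (k + 2)) a) ω) : ℝ) * Complex.I) ∂μ = 0 := by
  simp only [combo_zeroSum_sub_through]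
  let g : (A → ℝ) → ℝ := fun y => ∑ k ∈ range D, b k * ∑ x ∈ onlyAt (0 : Fin (k + 2)) a,
    ∏ s ∈ univ.erase 0, y (x s)
  let h : (A → ℝ) → ℝ := fun y => ∑ k ∈ range D, b k *
    ∑ x ∈ zeroSum A (Fin (k + 2)) with ¬ ∃ s, x s = a, ∏ s, y (x s)
  have hg : Measurable g := Finset.measurable_fun_sum _ fun k _ => (Finset.measurable_fun_sum _
    fun x _ => Finset.measurable_fun_prod _ fun s _ => measurable_pi_apply (x s)).const_mul (b k)
  have hh : Measurable h := Finset.measurable_fun_sum _ fun k _ => (Finset.measurable_fun_sum _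
    fun x _ => Finset.measurable_fun_prod _ fun s _ => measurable_pi_apply (x s)).const_mul (b k)
  have hgu : ∀ y, g (Function.update y a 0) = g y := by
    intro y
    refine sum_congr rfl fun k _ => congrArg _ (sum_congr rfl fun x hx => prod_congr rfl
      fun s hs => ?_)
    rw [Function.update_of_ne ((mem_onlyAt.1 hx).2.2 s (mem_erase.1 hs).1)]
  have hhu : ∀ y, h (Function.update y a 0) = h y := by
    intro y
    refine sum_congr rfl fun k _ => congrArg _ (sum_congr rfl fun x hx => prod_congr rfl
      fun s _ => ?_)
    rw [Function.update_of_ne fun hs => (mem_filter.1 hx).2 ⟨s, hs⟩]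
  have key := hY.integral_mul_eq_zero a
    (f := fun y => (g y : ℂ) * Complex.exp ((t * h y : ℝ) * Complex.I))
    ((Complex.measurable_ofReal.comp hg).mul (Complex.measurable_exp.comp
      ((Complex.measurable_ofReal.comp (hh.const_mul t)).mul_const _)))
    fun y => by simp only [hgu, hhu]
  rw [← key]
  refine integral_congr_ae (ae_of_all _ fun ω => ?_)
  have hmul : combo Y b D (fun k => onlyAt (0 : Fin (k + 2)) a) ω = Y a ω * g fun a => Y a ω := by
    simp only [combo, g]
    rw [mul_sum]
    refine sum_congr rfl fun k _ => ?_
    rw [mul_left_comm]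
    congr 1
    rw [mul_sum]
    refine sum_congr rfl fun x hx => ?_
    rw [mon, ← mul_prod_erase univ _ (mem_univ 0), (mem_onlyAt.1 hx).2.1]
  simp only
  rw [hmul, Complex.ofReal_mul, mul_assoc]
  rfl

end Statistic

/-! ### Bounds for the error terms -/

section ErrorBounds

variable {Ω : Type*} [MeasurableSpace Ω] {μ : Measure Ω} [IsProbabilityMeasure μ]
  {A : Type*} [AddCommGroup A] [Fintype A] [DecidableEq A] [IsAddCyclic A]
  {Y : A → Ω → ℝ} {M : ℕ → ℝ}

/-- The coefficients normalising the sum over zero-sum assignments to `k + 2` slots. -/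
noncomputable def scaled (α : ℕ → ℝ) (s : ℝ) (k : ℕ) : ℝ := α k / s ^ (k + 1)

theorem sqrt_card_pos : 0 < √(Fintype.card A : ℝ) :=
  Real.sqrt_pos.2 (Nat.cast_pos.2 (Fintype.card_pos_iff.2 ⟨0⟩))

theorem card_pow_eq (e : ℕ) : (Fintype.card A : ℝ) ^ e = √(Fintype.card A : ℝ) ^ (2 * e) := by
  rw [pow_mul, Real.sq_sqrt (Nat.cast_nonneg _)]

theorem integral_const_mul_sq_le {f : Ω → ℝ} {c K s : ℝ} (hs : 0 < s) (e : ℕ)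
    (h : ∫ ω, f ω ^ 2 ∂μ ≤ K * s ^ (2 * e)) :
    ∫ ω, (c / s ^ (e + 1) * f ω) ^ 2 ∂μ ≤ c ^ 2 * K / s ^ 2 := by
  simp only [mul_pow]
  rw [integral_const_mul]
  calc (c / s ^ (e + 1)) ^ 2 * ∫ ω, f ω ^ 2 ∂μ ≤ (c / s ^ (e + 1)) ^ 2 * (K * s ^ (2 * e)) := by
        gcongr
    _ = _ := by
        field_simp
        ring

theorem IsFamily.integral_abs_repeatedAt_le (hY : IsFamily μ M Y) (α : ℕ → ℝ) (D : ℕ) :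
    ∫ ω, |combo Y (scaled α √(Fintype.card A : ℝ)) D
        (fun k => repeatedAt A (0 : Fin (k + 2))) ω| ∂μ ≤
      (∑ k ∈ range D, (1 + α k ^ 2 * corankConst (Fin (k + 2) ⊕ Fin (k + 2)) M)) /
        √(Fintype.card A : ℝ) := by
  set s := √(Fintype.card A : ℝ)
  have hs : 0 < s := sqrt_card_pos
  unfold combo
  refine (integral_abs_sum_le _ fun k _ => (hY.hasMoments_sum_mon _).const_mul _).trans ?_
  rw [sum_div]
  refine sum_le_sum fun k _ => ?_
  refine ((hY.hasMoments_sum_mon _).const_mul _).integral_abs_le hs ?_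
  refine integral_const_mul_sq_le hs k ?_
  have := hY.integral_repeatedAt_sq_le (0 : Fin (k + 2)) (by simp)
  rwa [Fintype.card_fin, Nat.add_sub_cancel, card_pow_eq] at this

/-- The variance of the limiting Gaussian. -/
def limitVariance (α : ℕ → ℝ) (D : ℕ) : ℝ := ∑ k ∈ range D, α k ^ 2 * ((k + 2).factorial : ℝ)

/-- The constant of the bound `IsFamily.integral_abs_overlap_le`. -/
noncomputable def overlapConst (M : ℕ → ℝ) (α : ℕ → ℝ) (k m : ℕ) : ℝ :=
  if k = m then α k ^ 4 * (2 * (((k + 2).factorial : ℝ) ^ 2 * squareConst (Fin (k + 2)) M +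
    corankConst ((Fin (k + 2) ⊕ Fin (k + 2)) ⊕ (Fin (k + 2) ⊕ Fin (k + 2))) M))
  else (α k * α m) ^ 2 *
    corankConst ((Fin (k + 2) ⊕ Fin (m + 2)) ⊕ (Fin (k + 2) ⊕ Fin (m + 2))) M

theorem IsFamily.integral_overlap_term_sq_le (hY : IsFamily μ M Y) (α : ℕ → ℝ) (k m : ℕ) :
    ∫ ω, (scaled α √(Fintype.card A : ℝ) k * scaled α √(Fintype.card A : ℝ) m *
        ∑ p ∈ overlap A (Fin (m + 2)) (0 : Fin (k + 2)), mon Y p ω -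
        if k = m then α k ^ 2 * ((k + 2).factorial : ℝ) else 0) ^ 2 ∂μ ≤
      overlapConst M α k m / √(Fintype.card A : ℝ) ^ 2 := by
  set s := √(Fintype.card A : ℝ)
  have hs : 0 < s := sqrt_card_pos
  by_cases hkm : k = m
  · subst hkm
    simp only [if_true, overlapConst]
    have h1 : ∀ ω, scaled α s k * scaled α s k *
        ∑ p ∈ overlap A (Fin (k + 2)) (0 : Fin (k + 2)), mon Y p ω -
        α k ^ 2 * ((k + 2).factorial : ℝ) = α k ^ 2 / s ^ (2 * k + 1 + 1) *
          (∑ p ∈ overlap A (Fin (k + 2)) (0 : Fin (k + 2)), mon Y p ω -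
            ((k + 2).factorial : ℝ) * s ^ (2 * (k + 1))) := by
      intro ω
      have h : s ^ (2 * k + 1 + 1) = s ^ (k + 1) * s ^ (k + 1) := by ring
      have h' : s ^ (2 * (k + 1)) = s ^ (k + 1) * s ^ (k + 1) := by ring
      rw [scaled, h, h']
      field_simp
    simp only [h1]
    have h2 := hY.integral_overlap_sub_sq_le (ι := Fin (k + 2)) (by simp) 0
    rw [Fintype.card_fin, show k + 2 - 1 = k + 1 by omega,
      show 2 * (k + 2) - 3 = 2 * k + 1 by omega, card_pow_eq, card_pow_eq] at h2
    have := integral_const_mul_sq_le (c := α k ^ 2) hs _ h2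
    rwa [← pow_mul] at this
  · simp only [if_neg hkm, overlapConst, sub_zero]
    have h1 : ∀ ω, scaled α s k * scaled α s m *
        ∑ p ∈ overlap A (Fin (m + 2)) (0 : Fin (k + 2)), mon Y p ω =
          α k * α m / s ^ (k + m + 1 + 1) *
            ∑ p ∈ overlap A (Fin (m + 2)) (0 : Fin (k + 2)), mon Y p ω := by
      intro ω
      have : s ^ (k + m + 1 + 1) = s ^ (k + 1) * s ^ (m + 1) := by ring
      rw [scaled, scaled, this]
      field_simp
    simp only [h1]
    have h2 := hY.integral_overlap_sq_le (ι := Fin (k + 2)) (κ := Fin (m + 2)) (by simp) (by simp)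
      (by simpa using hkm) 0
    rw [Fintype.card_fin, Fintype.card_fin, show k + 2 + (m + 2) - 3 = k + m + 1 by omega,
      card_pow_eq] at h2
    exact integral_const_mul_sq_le hs _ h2

theorem IsFamily.integral_abs_overlap_le (hY : IsFamily μ M Y) (α : ℕ → ℝ) (D : ℕ) :
    ∫ ω, |∑ a : A, combo Y (scaled α √(Fintype.card A : ℝ)) D
        (fun k => onlyAt (0 : Fin (k + 2)) a) ω *
        combo Y (scaled α √(Fintype.card A : ℝ)) D (fun k => through (Fin (k + 2)) a) ω -
        limitVariance α D| ∂μ ≤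
      (∑ k ∈ range D, ∑ m ∈ range D, (1 + overlapConst M α k m)) / √(Fintype.card A : ℝ) := by
  set s := √(Fintype.card A : ℝ)
  have hs : 0 < s := sqrt_card_pos
  have hid : ∀ ω, ∑ a : A, combo Y (scaled α s) D (fun k => onlyAt (0 : Fin (k + 2)) a) ω *
        combo Y (scaled α s) D (fun k => through (Fin (k + 2)) a) ω - limitVariance α D =
      ∑ k ∈ range D, ∑ m ∈ range D, (scaled α s k * scaled α s m *
        ∑ p ∈ overlap A (Fin (m + 2)) (0 : Fin (k + 2)), mon Y p ω -
        if k = m then α k ^ 2 * ((k + 2).factorial : ℝ) else 0) := by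
    intro ω
    have hv : limitVariance α D = ∑ k ∈ range D, ∑ m ∈ range D,
        if k = m then α k ^ 2 * ((k + 2).factorial : ℝ) else 0 := by
      refine sum_congr rfl fun k hk => ?_
      rw [sum_ite_eq, if_pos hk]
    simp only [sum_sub_distrib]
    rw [← hv]
    congr 1
    simp only [combo, sum_mul_sum]
    rw [sum_comm]
    refine sum_congr rfl fun k _ => ?_
    rw [sum_comm]
    refine sum_congr rfl fun m _ => ?_
    rw [← sum_onlyAt_mul_through, mul_sum]
    exact sum_congr rfl fun a _ => by ring
  have hmom : ∀ k m, HasMoments μ fun ω => scaled α s k * scaled α s m *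
        ∑ p ∈ overlap A (Fin (m + 2)) (0 : Fin (k + 2)), mon Y p ω -
        if k = m then α k ^ 2 * ((k + 2).factorial : ℝ) else 0 := fun k m =>
    ((hY.hasMoments_sum_mon _).const_mul _).sub (HasMoments.const _)
  simp only [hid]
  refine (integral_abs_sum_le _ fun k _ => HasMoments.sum _ fun m _ => hmom k m).trans ?_
  rw [sum_div]
  refine sum_le_sum fun k _ => ?_
  refine (integral_abs_sum_le _ fun m _ => hmom k m).trans ?_
  rw [sum_div]
  exact sum_le_sum fun m _ => (hmom k m).integral_abs_le hs (hY.integral_overlap_term_sq_le α k m)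

theorem sum_integral_sum_const_mul_pow {A : Type*} [Fintype A] {f : ℕ → A → Ω → ℝ} (S : Finset ℕ)
    (c : ℕ → ℝ) (hf : ∀ k a, HasMoments μ (f k a)) (K : ℝ) (j : ℕ) :
    ∑ a : A, ∫ ω, K * ∑ k ∈ S, (c k * f k a ω) ^ j ∂μ =
      K * ∑ k ∈ S, c k ^ j * ∑ a : A, ∫ ω, f k a ω ^ j ∂μ := by
  simp only [integral_const_mul, mul_pow]
  rw [← mul_sum]
  congr 1
  simp only [mul_sum]
  rw [sum_comm]
  refine sum_congr rfl fun a _ => ?_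
  rw [integral_finsetSum _ fun k _ => ((hf k a).integrable_pow j).const_mul _]
  exact sum_congr rfl fun k _ => integral_const_mul _ _

theorem IsFamily.sum_integral_combo_onlyAt_sq_le (hY : IsFamily μ M Y) (α : ℕ → ℝ) (D : ℕ) :
    ∑ a : A, ∫ ω, combo Y (scaled α √(Fintype.card A : ℝ)) D
        (fun k => onlyAt (0 : Fin (k + 2)) a) ω ^ 2 ∂μ ≤
      D * ∑ k ∈ range D, α k ^ 2 * (Fintype.card (Fin (k + 2) ⊕ Fin (k + 2)) *
        corankConst (Fin (k + 2) ⊕ Fin (k + 2)) M) := by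
  set s := √(Fintype.card A : ℝ)
  have hs : 0 < s := sqrt_card_pos
  have hm : ∀ (k : ℕ) (a : A), HasMoments μ fun ω =>
      scaled α s k * ∑ x ∈ onlyAt (0 : Fin (k + 2)) a, mon Y x ω := fun k a =>
    (hY.hasMoments_sum_mon _).const_mul _
  calc ∑ a : A, ∫ ω, combo Y (scaled α s) D (fun k => onlyAt (0 : Fin (k + 2)) a) ω ^ 2 ∂μ
      ≤ ∑ a : A, ∫ ω, D * ∑ k ∈ range D,
          (scaled α s k * ∑ x ∈ onlyAt (0 : Fin (k + 2)) a, mon Y x ω) ^ 2 ∂μ := by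
        refine sum_le_sum fun a _ => integral_mono ((hY.hasMoments_combo _ _ _).integrable_pow 2)
          ((HasMoments.sum _ fun k _ => (hm k a).pow 2).const_mul _).integrable fun ω => ?_
        have := sq_sum_le_card_mul_sum_sq (s := range D)
          (f := fun k => scaled α s k * ∑ x ∈ onlyAt (0 : Fin (k + 2)) a, mon Y x ω)
        rwa [card_range] at this
    _ = D * ∑ k ∈ range D, scaled α s k ^ 2 *
          ∑ a : A, ∫ ω, (∑ x ∈ onlyAt (0 : Fin (k + 2)) a, mon Y x ω) ^ 2 ∂μ := by
        exact sum_integral_sum_const_mul_pow _ _ (fun k a => hY.hasMoments_sum_mon _) _ 2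
    _ ≤ _ := by
        refine mul_le_mul_of_nonneg_left (sum_le_sum fun k _ => ?_) (Nat.cast_nonneg D)
        have := hY.sum_integral_onlyAt_sq_le (0 : Fin (k + 2))
        rw [Fintype.card_fin, show k + 2 - 1 = k + 1 by omega, card_pow_eq] at this
        refine (mul_le_mul_of_nonneg_left this (sq_nonneg _)).trans_eq ?_
        change scaled α s k ^ 2 * (_ * s ^ (2 * (k + 1))) = _
        rw [scaled]
        field_simp
        ring

theorem IsFamily.sum_integral_combo_through_pow_le (hY : IsFamily μ M Y) (α : ℕ → ℝ) (D : ℕ) :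
    ∑ a : A, ∫ ω, combo Y (scaled α √(Fintype.card A : ℝ)) D
        (fun k => through (Fin (k + 2)) a) ω ^ 4 ∂μ ≤
      (D ^ 3 * ∑ k ∈ range D, α k ^ 4 *
        (Fintype.card ((Fin (k + 2) ⊕ Fin (k + 2)) ⊕ (Fin (k + 2) ⊕ Fin (k + 2))) *
        corankConst ((Fin (k + 2) ⊕ Fin (k + 2)) ⊕ (Fin (k + 2) ⊕ Fin (k + 2))) M)) /
          √(Fintype.card A : ℝ) ^ 2 := by
  set s := √(Fintype.card A : ℝ)
  have hs : 0 < s := sqrt_card_pos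
  have hm : ∀ (k : ℕ) (a : A), HasMoments μ fun ω =>
      scaled α s k * ∑ x ∈ through (Fin (k + 2)) a, mon Y x ω := fun k a =>
    (hY.hasMoments_sum_mon _).const_mul _
  calc ∑ a : A, ∫ ω, combo Y (scaled α s) D (fun k => through (Fin (k + 2)) a) ω ^ 4 ∂μ
      ≤ ∑ a : A, ∫ ω, D ^ 3 * ∑ k ∈ range D,
          (scaled α s k * ∑ x ∈ through (Fin (k + 2)) a, mon Y x ω) ^ 4 ∂μ := by
        refine sum_le_sum fun a _ => integral_mono ((hY.hasMoments_combo _ _ _).integrable_pow 4)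
          ((HasMoments.sum _ fun k _ => (hm k a).pow 4).const_mul _).integrable fun ω => ?_
        have h1 := sq_sum_le_card_mul_sum_sq (s := range D)
          (f := fun k => scaled α s k * ∑ x ∈ through (Fin (k + 2)) a, mon Y x ω)
        have h2 := sq_sum_le_card_mul_sum_sq (s := range D)
          (f := fun k => (scaled α s k * ∑ x ∈ through (Fin (k + 2)) a, mon Y x ω) ^ 2)
        simp only [← pow_mul, card_range] at h1 h2
        have h3 := pow_le_pow_left₀ (sq_nonneg _) h1 2
        simp only
        rw [combo]
        calc _ = _ := by rw [show 4 = 2 * 2 by norm_num, pow_mul]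
          _ ≤ _ := h3
          _ = (D : ℝ) ^ 2 * _ := mul_pow _ _ _
          _ ≤ (D : ℝ) ^ 2 * _ := mul_le_mul_of_nonneg_left h2 (sq_nonneg _)
          _ = _ := by ring
    _ = D ^ 3 * ∑ k ∈ range D, scaled α s k ^ 4 *
          ∑ a : A, ∫ ω, (∑ x ∈ through (Fin (k + 2)) a, mon Y x ω) ^ 4 ∂μ := by
        exact sum_integral_sum_const_mul_pow _ _ (fun k a => hY.hasMoments_sum_mon _) _ 4
    _ ≤ _ := by
        rw [mul_div_assoc, sum_div]
        refine mul_le_mul_of_nonneg_left (sum_le_sum fun k _ => ?_) (by positivity)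
        have := hY.sum_integral_through_pow_le (ι := Fin (k + 2)) (by simp)
        rw [Fintype.card_fin, show 2 * (k + 2) - 3 = 2 * k + 1 by omega, card_pow_eq] at this
        refine (mul_le_mul_of_nonneg_left this (by positivity)).trans_eq ?_
        change scaled α s k ^ 4 * (_ * s ^ (2 * (2 * k + 1))) = _
        rw [scaled]
        field_simp
        ring

/-- By `|V| W ^ 2 ≤ s⁻¹ V ^ 2 + s W ^ 4`. -/
theorem IsFamily.sum_integral_abs_mul_sq_le (hY : IsFamily μ M Y) (α : ℕ → ℝ) (D : ℕ) {K L : ℝ}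
    (hK : ∑ a : A, ∫ ω, combo Y (scaled α √(Fintype.card A : ℝ)) D
        (fun k => onlyAt (0 : Fin (k + 2)) a) ω ^ 2 ∂μ ≤ K)
    (hL : ∑ a : A, ∫ ω, combo Y (scaled α √(Fintype.card A : ℝ)) D
        (fun k => through (Fin (k + 2)) a) ω ^ 4 ∂μ ≤ L / √(Fintype.card A : ℝ) ^ 2) :
    ∑ a : A, ∫ ω, |combo Y (scaled α √(Fintype.card A : ℝ)) D
        (fun k => onlyAt (0 : Fin (k + 2)) a) ω| *
        combo Y (scaled α √(Fintype.card A : ℝ)) D (fun k => through (Fin (k + 2)) a) ω ^ 2 ∂μ ≤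
      (K + L) / √(Fintype.card A : ℝ) := by
  set s := √(Fintype.card A : ℝ)
  have hs : 0 < s := sqrt_card_pos
  set V : A → Ω → ℝ := fun a => combo Y (scaled α s) D (fun k => onlyAt (0 : Fin (k + 2)) a)
  set W : A → Ω → ℝ := fun a => combo Y (scaled α s) D (fun k => through (Fin (k + 2)) a)
  have hV : ∀ a, HasMoments μ (V a) := fun a => hY.hasMoments_combo _ _ _
  have hW : ∀ a, HasMoments μ (W a) := fun a => hY.hasMoments_combo _ _ _
  calc ∑ a : A, ∫ ω, |V a ω| * W a ω ^ 2 ∂μ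
      ≤ ∑ a : A, ∫ ω, (s⁻¹ * V a ω ^ 2 + s * W a ω ^ 4) ∂μ := by
        refine sum_le_sum fun a _ => integral_mono ((hV a).abs.mul ((hW a).pow 2)).integrable
          (((hV a).pow 2).const_mul _ |>.add (((hW a).pow 4).const_mul s)).integrable fun ω => ?_
        simp only
        have h1 : s⁻¹ * V a ω ^ 2 + s * W a ω ^ 4 - |V a ω| * W a ω ^ 2 =
            s⁻¹ * ((|V a ω| - s * W a ω ^ 2) ^ 2 + |V a ω| * (s * W a ω ^ 2)) := by
          rw [← sq_abs (V a ω)]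
          field_simp
          ring
        have h2 : 0 ≤ s⁻¹ * ((|V a ω| - s * W a ω ^ 2) ^ 2 + |V a ω| * (s * W a ω ^ 2)) := by
          positivity
        linarith
    _ = s⁻¹ * ∑ a : A, ∫ ω, V a ω ^ 2 ∂μ + s * ∑ a : A, ∫ ω, W a ω ^ 4 ∂μ := by
        rw [mul_sum, mul_sum, ← sum_add_distrib]
        refine sum_congr rfl fun a _ => ?_
        rw [integral_add (((hV a).pow 2).const_mul _).integrable
          (((hW a).pow 4).const_mul s).integrable, integral_const_mul, integral_const_mul]
    _ ≤ s⁻¹ * K + s * (L / s ^ 2) := by gcongr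
    _ = _ := by field_simp

/-- The error in the differential equation for the characteristic function of the normalised
statistic is `O(|A|^{-1/2})`, locally uniformly in `t`. -/
theorem exists_norm_integral_mul_exp_sub_le (μ : Measure Ω) [IsProbabilityMeasure μ] (M : ℕ → ℝ)
    (α : ℕ → ℝ) (D : ℕ) :
    ∃ C, 0 ≤ C ∧ ∀ {A : Type} [AddCommGroup A] [Fintype A] [DecidableEq A] [IsAddCyclic A]
      {Y : A → Ω → ℝ}, IsFamily μ M Y → ∀ {T : Ω → ℝ},
      (∀ ω, T ω = combo Y (scaled α √(Fintype.card A : ℝ)) D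
        (fun k => zeroSum A (Fin (k + 2))) ω) → ∀ t : ℝ,
      ‖∫ ω, (T ω : ℂ) * Complex.exp ((t * T ω : ℝ) * Complex.I) ∂μ -
        limitVariance α D * t * Complex.I * ∫ ω, Complex.exp ((t * T ω : ℝ) * Complex.I) ∂μ‖ ≤
      (1 + |t| + 3 * t ^ 2) * (C / √(Fintype.card A : ℝ)) := by
  let C₁ := ∑ k ∈ range D, (1 + α k ^ 2 * corankConst (Fin (k + 2) ⊕ Fin (k + 2)) M)
  let C₂ := ∑ k ∈ range D, ∑ m ∈ range D, (1 + overlapConst M α k m)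
  let K := D * ∑ k ∈ range D, α k ^ 2 * (Fintype.card (Fin (k + 2) ⊕ Fin (k + 2)) *
    corankConst (Fin (k + 2) ⊕ Fin (k + 2)) M)
  let L := D ^ 3 * ∑ k ∈ range D, α k ^ 4 *
    (Fintype.card ((Fin (k + 2) ⊕ Fin (k + 2)) ⊕ (Fin (k + 2) ⊕ Fin (k + 2))) *
      corankConst ((Fin (k + 2) ⊕ Fin (k + 2)) ⊕ (Fin (k + 2) ⊕ Fin (k + 2))) M)
  refine ⟨max (max (max 0 C₁) C₂) (K + L), (le_max_left _ _).trans ((le_max_left _ _).trans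
    (le_max_left _ _)), ?_⟩
  intro A _ _ _ _ Y hY T hT t
  have hs : 0 < √(Fintype.card A : ℝ) := sqrt_card_pos
  obtain rfl : T = _ := funext hT
  refine (norm_integral_mul_exp_sub_le (hY.hasMoments_combo _ _ _) (hY.hasMoments_combo _ _ _)
    (fun a => hY.hasMoments_combo _ _ _) (fun a => hY.hasMoments_combo _ _ _)
    (fun ω => combo_zeroSum _ D ω) t (limitVariance α D)
    fun a => hY.integral_onlyAt_mul_exp_eq_zero _ D t a).trans ?_
  rw [add_mul, add_mul, one_mul]
  refine add_le_add (add_le_add ?_ ?_) ?_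
  · refine (hY.integral_abs_repeatedAt_le α D).trans ?_
    refine div_le_div_of_nonneg_right ?_ hs.le
    exact (le_max_right 0 C₁).trans ((le_max_left _ _).trans (le_max_left _ _))
  · refine mul_le_mul_of_nonneg_left ?_ (abs_nonneg t)
    refine (hY.integral_abs_overlap_le α D).trans ?_
    refine div_le_div_of_nonneg_right ?_ hs.le
    exact (le_max_right _ C₂).trans (le_max_left _ _)
  · refine mul_le_mul_of_nonneg_left ?_ (by positivity)
    refine (hY.sum_integral_abs_mul_sq_le α D (hY.sum_integral_combo_onlyAt_sq_le α D)
      (hY.sum_integral_combo_through_pow_le α D)).trans ?_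
    refine div_le_div_of_nonneg_right ?_ hs.le
    exact le_max_right _ (K + L)

/-- The statistic is asymptotically centred. -/
theorem exists_abs_integral_le (μ : Measure Ω) [IsProbabilityMeasure μ] (M : ℕ → ℝ)
    (α : ℕ → ℝ) (D : ℕ) :
    ∃ C, ∀ {A : Type} [AddCommGroup A] [Fintype A] [DecidableEq A] [IsAddCyclic A]
      {Y : A → Ω → ℝ}, IsFamily μ M Y →
      |∫ ω, combo Y (scaled α √(Fintype.card A : ℝ)) D (fun k => zeroSum A (Fin (k + 2))) ω ∂μ| ≤
        C / √(Fintype.card A : ℝ) := by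
  refine ⟨∑ k ∈ range D, |α k| * corankConst (Fin (k + 2)) M, ?_⟩
  intro A _ _ _ _ Y hY
  set s := √(Fintype.card A : ℝ) with hsdef
  have hs : 0 < s := sqrt_card_pos
  have hs1 : 1 ≤ s := by
    rw [hsdef, Real.one_le_sqrt]
    exact_mod_cast Fintype.card_pos_iff.2 ⟨(0 : A)⟩
  unfold combo
  rw [integral_finsetSum _ fun k _ => ((hY.hasMoments_sum_mon _).const_mul _).integrable, sum_div]
  refine (abs_sum_le_sum_abs _ _).trans (sum_le_sum fun k _ => ?_)
  rw [integral_const_mul, abs_mul]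
  have := hY.abs_integral_zeroSum_le (ι := Fin (k + 2)) (by simp)
  rw [Fintype.card_fin, card_pow_eq] at this
  have hb : |scaled α s k| = |α k| / s ^ (k + 1) := by
    rw [scaled, abs_div, abs_of_pos (pow_pos hs _)]
  rw [hb]
  calc |α k| / s ^ (k + 1) * |∫ ω, ∑ x ∈ zeroSum A (Fin (k + 2)), mon Y x ω ∂μ|
      ≤ |α k| / s ^ (k + 1) * (corankConst (Fin (k + 2)) M * s ^ (2 * ((k + 2) / 2 - 1))) := by
        gcongr
    _ ≤ |α k| / s ^ (k + 1) * (corankConst (Fin (k + 2)) M * s ^ k) := by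
        have := corankConst_nonneg (ι := Fin (k + 2)) M
        gcongr
        omega
    _ = _ := by
        rw [pow_succ]
        field_simp

end ErrorBounds

/-! ### Integration of the differential equation -/

section Limit

variable {Ω : Type*} [MeasurableSpace Ω] {μ : Measure Ω} [IsProbabilityMeasure μ]

theorem HasMoments.hasDerivAt_integral_exp {T : Ω → ℝ} (hT : HasMoments μ T) (t : ℝ) :
    HasDerivAt (fun t : ℝ => ∫ ω, Complex.exp ((t * T ω : ℝ) * Complex.I) ∂μ)
      (Complex.I * ∫ ω, (T ω : ℂ) * Complex.exp ((t * T ω : ℝ) * Complex.I) ∂μ) t := by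
  rw [← integral_const_mul]
  refine (hasDerivAt_integral_of_dominated_loc_of_deriv_le (bound := fun ω => |T ω|)
    (F' := fun t ω => Complex.I * ((T ω : ℂ) * Complex.exp ((t * T ω : ℝ) * Complex.I)))
    (Metric.ball_mem_nhds t one_pos) (.of_forall fun u => ?_) ?_ ?_ (.of_forall fun ω u _ => ?_)
    hT.abs.integrable (.of_forall fun ω u _ => ?_)).2
  · simpa using ((HasMoments.const (μ := μ) 1).integrable_mul_exp hT u).aestronglyMeasurable
  · simpa using (HasMoments.const (μ := μ) 1).integrable_mul_exp hT t
  · exact ((hT.integrable_mul_exp hT t).const_mul Complex.I).aestronglyMeasurable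
  · rw [norm_mul, norm_mul, Complex.norm_I, Complex.norm_exp_ofReal_mul_I]
    simp
  · have h1 : HasDerivAt (fun u : ℝ => ((u * T ω : ℝ) : ℂ) * Complex.I) (T ω * Complex.I) u := by
      have := ((hasDerivAt_id u).mul_const (T ω)).ofReal_comp.mul_const Complex.I
      simpa using this
    convert! h1.cexp using 1
    ring

/-- Grönwall-type integration of the approximate equation `φ' = - v t φ`, `φ 0 = 1`. -/
theorem HasMoments.norm_exp_mul_integral_sub_one_le {T : Ω → ℝ} (hT : HasMoments μ T) {v δ : ℝ}
    (hv : 0 ≤ v) (hδ : 0 ≤ δ)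
    (h : ∀ t : ℝ, ‖∫ ω, (T ω : ℂ) * Complex.exp ((t * T ω : ℝ) * Complex.I) ∂μ -
        v * t * Complex.I * ∫ ω, Complex.exp ((t * T ω : ℝ) * Complex.I) ∂μ‖ ≤
      (1 + |t| + 3 * t ^ 2) * δ) (t : ℝ) :
    ‖Complex.exp ((v * t ^ 2 / 2 : ℝ)) * ∫ ω, Complex.exp ((t * T ω : ℝ) * Complex.I) ∂μ - 1‖ ≤
      Real.exp (v * t ^ 2 / 2) * ((1 + |t| + 3 * t ^ 2) * δ) * |t| := by
  set φ : ℝ → ℂ := fun t => ∫ ω, Complex.exp ((t * T ω : ℝ) * Complex.I) ∂μ with hφ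
  set G : ℝ → ℂ := fun u => Complex.exp ((v * u ^ 2 / 2 : ℝ)) * φ u with hG
  have hG0 : G 0 = 1 := by simp [hG, hφ]
  have hderiv : ∀ u : ℝ, HasDerivAt G (Complex.exp ((v * u ^ 2 / 2 : ℝ)) * (Complex.I *
      (∫ ω, (T ω : ℂ) * Complex.exp ((u * T ω : ℝ) * Complex.I) ∂μ -
        v * u * Complex.I * φ u))) u := by
    intro u
    have h1 : HasDerivAt (fun u : ℝ => ((v * u ^ 2 / 2 : ℝ) : ℂ)) ((v * u : ℝ) : ℂ) u := by
      refine HasDerivAt.ofReal_comp ?_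
      convert! ((hasDerivAt_pow 2 u).const_mul v).div_const 2 using 1
      simp
      ring
    convert! h1.cexp.mul (hT.hasDerivAt_integral_exp u) using 1
    rw [mul_sub, mul_sub, show ∀ z : ℂ, Complex.I * (v * u * Complex.I * z) = -(v * u * z) by
      intro z; linear_combination (v * u * z) * Complex.I_sq]
    simp only [hφ]
    push_cast
    ring
  have key := (convex_Icc (-|t|) |t|).norm_image_sub_le_of_norm_hasDerivWithin_le
    (C := Real.exp (v * t ^ 2 / 2) * ((1 + |t| + 3 * t ^ 2) * δ))
    (fun u _ => (hderiv u).hasDerivWithinAt) (fun u hu => ?_)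
    (x := 0) (y := t) (by simp) ⟨neg_abs_le t, le_abs_self t⟩
  · rw [hG0] at key
    simpa [hG, hφ] using key
  · have hut : |u| ≤ |t| := abs_le.2 hu
    have hut2 : u ^ 2 ≤ t ^ 2 := sq_le_sq.2 hut
    rw [norm_mul, norm_mul, Complex.norm_I, one_mul, Complex.norm_exp_ofReal]
    refine mul_le_mul ?_ ((h u).trans ?_) (norm_nonneg _) (Real.exp_pos _).le
    · exact Real.exp_le_exp.2 (by gcongr)
    · gcongr

end Limit

/-! ### Traces of powers of circulant matrices -/

section Trace

/-- Entries of powers of a circulant matrix: the increments of a path from `i` to `j` sum to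
`j - i`. -/
theorem circ_pow_apply (n : ℕ) [NeZero n] (x : ℕ → ℝ) (l : ℕ) (i j : Fin n) :
    (circ n x ^ l) i j = ∑ y : Fin l → Fin n with ∑ s, y s = j - i, ∏ s, x (y s) := by
  induction l generalizing i with
  | zero =>
    by_cases h : i = j
    · subst h; simp
    · simp [h, sub_eq_zero, Ne.symm h, eq_comm]
  | succ l ih =>
    rw [pow_succ', Matrix.mul_apply, sum_filter, ← (Fin.consEquiv fun _ => Fin n).sum_comp,
      Fintype.sum_prod_type, ← Equiv.sum_comp (Equiv.addRight i)]
    refine sum_congr rfl fun k _ => ?_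
    rw [circ_apply, ih, sum_filter, mul_sum]
    refine sum_congr rfl fun y _ => ?_
    simp only [Fin.consEquiv_apply, Fin.sum_univ_succ, Fin.prod_univ_succ, Fin.cons_zero,
      Fin.cons_succ, Equiv.coe_addRight, add_sub_cancel_right]
    have : ∑ s, y s = j - (k + i) ↔ k + ∑ s, y s = j - i := by
      rw [eq_sub_iff_add_eq, eq_sub_iff_add_eq, show ∑ s, y s + (k + i) = k + ∑ s, y s + i by abel]
    simp only [this, mul_ite, mul_zero]

theorem trace_circ_pow (n : ℕ) [NeZero n] (x : ℕ → ℝ) (l : ℕ) :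
    (circ n x ^ l).trace = n * ∑ y ∈ zeroSum (Fin n) (Fin l), ∏ s, x (y s) := by
  simp only [Matrix.trace, Matrix.diag_apply, circ_pow_apply, sub_self]
  rw [sum_const, card_univ, Fintype.card_fin, nsmul_eq_mul]
  rfl

variable {Ω : Type*}

theorem linStat_eq (X : ℕ → Ω → ℝ) (d : ℕ) (hd : 2 ≤ d) (a : ℕ → ℝ) (n : ℕ) [NeZero n] (ω : Ω) :
    linStat X d a n ω = √(n : ℝ) * combo (fun i : Fin n => X i) (scaled (fun k => a (k + 2)) √(n : ℝ))
      (d - 1) (fun k => zeroSum (Fin n) (Fin (k + 2))) ω := by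
  have hn : 0 < √(n : ℝ) := Real.sqrt_pos.2 (Nat.cast_pos.2 (NeZero.pos n))
  have hd' : Icc 2 d = Ico (0 + 2) (d - 1 + 2) := by
    ext k; simp only [mem_Icc, mem_Ico]; omega
  have h1 : linStat X d a n ω = ∑ k ∈ Icc 2 d, a k * (randCirc X n ω ^ k).trace := by
    simp [linStat, testPoly, Matrix.trace_sum, Polynomial.aeval_C, ← Algebra.smul_def,
      Matrix.trace_smul]
  rw [h1, hd', ← sum_Ico_add' (fun k => a k * (randCirc X n ω ^ k).trace) 0 (d - 1) 2,
    ← range_eq_Ico, combo, mul_sum]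
  refine sum_congr rfl fun k _ => ?_
  rw [randCirc, trace_circ_pow]
  simp only [prod_div_distrib, prod_const, card_univ, Fintype.card_fin]
  rw [← sum_div, scaled]
  simp only [mon]
  have : (n : ℝ) = √(n : ℝ) * √(n : ℝ) := (Real.mul_self_sqrt (Nat.cast_nonneg n)).symm
  rw [show k + 2 = k + 1 + 1 from rfl, pow_succ (√(n : ℝ)) (k + 1)]
  field_simp
  rw [Real.sq_sqrt (Nat.cast_nonneg n)]
  ring

end Trace

/-! ### The limiting variance -/

section Variance

open fwdDiff in
/-- Summation over `s` collapses the inner alternating sums of binomial coefficients, and leaves the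
iterated forward difference of `x ^ (k + 1)` at `0`. -/
theorem sum_range_f (k : ℕ) : ∑ s ∈ range (k + 2), f (k + 2) s = 1 := by
  have hk : ((k + 1).factorial : ℝ) ≠ 0 := by positivity
  simp only [f]
  rw [← mul_sum, show k + 2 - 1 = k + 1 from rfl, one_div, inv_mul_eq_one₀ hk]
  have hdiff := congrFun (fwdDiff_iter_eq_factorial (R := ℝ) (n := k + 1)) 0
  rw [fwdDiff_iter_eq_sum_shift] at hdiff
  simp only [Pi.natCast_apply] at hdiff
  rw [← hdiff]
  have halt : ∀ m : ℕ, ∑ i ∈ range (m + 1), (-1 : ℝ) ^ i * ((k + 2).choose i : ℝ) =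
      (-1) ^ m * ((k + 1).choose m : ℝ) := by
    intro m
    have := Int.alternating_sum_range_choose_eq_choose (n := k + 1) (m := m)
    exact_mod_cast this
  have hsig : ∑ s ∈ range (k + 2), ∑ i ∈ range (s + 1),
      (-1 : ℝ) ^ i * ((k + 2).choose i : ℝ) * ((s : ℝ) - (i : ℝ)) ^ (k + 1) =
      ∑ u ∈ range (k + 2), ∑ i ∈ range (k + 1 - u + 1),
        (-1 : ℝ) ^ i * ((k + 2).choose i : ℝ) * (u : ℝ) ^ (k + 1) := by
    rw [sum_sigma', sum_sigma']
    refine sum_bij' (fun x _ => ⟨x.1 - x.2, x.2⟩) (fun x _ => ⟨x.1 + x.2, x.2⟩) ?_ ?_ ?_ ?_ ?_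
    · rintro ⟨s, i⟩ h
      simp only [mem_sigma, mem_range] at h ⊢
      omega
    · rintro ⟨u, i⟩ h
      simp only [mem_sigma, mem_range] at h ⊢
      omega
    · rintro ⟨s, i⟩ h
      simp only [mem_sigma, mem_range] at h
      simp only [Sigma.mk.injEq, heq_eq_eq, and_true]
      omega
    · rintro ⟨u, i⟩ h
      simp
    · rintro ⟨s, i⟩ h
      simp only [mem_sigma, mem_range] at h
      have hi : i ≤ s := Nat.lt_succ_iff.1 h.2
      simp only [Nat.cast_sub hi]
  rw [hsig]
  refine sum_congr rfl fun u hu => ?_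
  have hu := mem_range.1 hu
  rw [← sum_mul, halt, Nat.choose_symm (by omega)]
  simp

theorem limVar_eq (d : ℕ) (hd : 2 ≤ d) (a : ℕ → ℝ) :
    limVar d a = limitVariance (fun k => a (k + 2)) (d - 1) := by
  have hd' : Icc 2 d = Ico (0 + 2) (d - 1 + 2) := by
    ext k; simp only [mem_Icc, mem_Ico]; omega
  rw [limVar, limitVariance, hd', ← sum_Ico_add' _ 0 (d - 1) 2, ← range_eq_Ico]
  refine sum_congr rfl fun k _ => ?_
  rw [sum_range_f, mul_one]

end Variance

/-- `Fin n` is `ZMod n` for `n ≠ 0`. -/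
theorem isAddCyclic_fin (n : ℕ) [NeZero n] : IsAddCyclic (Fin n) := by
  obtain ⟨m, rfl⟩ := Nat.exists_eq_succ_of_ne_zero (NeZero.ne n)
  exact inferInstanceAs (IsAddCyclic (ZMod (m + 1)))

/-! ### Convergence in distribution -/

section Main
open scoped Topology

variable {Ω : Type*} [MeasurableSpace Ω] {μ : Measure Ω} [IsProbabilityMeasure μ]

/-- The hypotheses of the central limit theorem provide a common moment bound. -/
theorem exists_isFamily {X : ℕ → Ω → ℝ} (hmeas : ∀ i, Measurable (X i)) (hindep : iIndepFun X μ)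
    (hmean : ∀ i, ∫ ω, X i ω ∂μ = 0) (hvar : ∀ i, ∫ ω, X i ω ^ 2 ∂μ = 1)
    (hmom : ∀ k : ℕ, 3 ≤ k → ∃ α : ℝ, ∀ i,
      Integrable (fun ω => |X i ω| ^ k) μ ∧ ∫ ω, |X i ω| ^ k ∂μ ≤ α) :
    ∃ M, IsFamily μ M X := by
  have hmoments : ∀ i, HasMoments μ (X i) := by
    refine fun i => ⟨hmeas i, fun k => ?_⟩
    obtain ⟨_, h⟩ := hmom (k + 3) (by omega)
    refine ((integrable_const (1 : ℝ)).add (h i).1).mono'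
      ((hmeas i).abs.pow_const k).aestronglyMeasurable (ae_of_all _ fun ω => ?_)
    simp only [Pi.add_apply, Real.norm_eq_abs, abs_pow, abs_abs]
    rcases le_total |X i ω| 1 with h1 | h1
    · linarith [pow_le_one₀ (n := k) (abs_nonneg _) h1, pow_nonneg (abs_nonneg (X i ω)) (k + 3)]
    · linarith [pow_le_pow_right₀ h1 (show k ≤ k + 3 by omega)]
  have hbound : ∀ k : ℕ, ∃ α : ℝ, ∀ i, ∫ ω, |X i ω| ^ k ∂μ ≤ α := by
    intro k
    obtain ⟨α, h⟩ := hmom (k + 3) (by omega)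
    refine ⟨1 + α, fun i => ?_⟩
    calc ∫ ω, |X i ω| ^ k ∂μ ≤ ∫ ω, (1 + |X i ω| ^ (k + 3)) ∂μ := by
          refine integral_mono ((hmoments i).2 k) ((integrable_const _).add (h i).1) fun ω => ?_
          simp only
          rcases le_total |X i ω| 1 with h1 | h1
          · linarith [pow_le_one₀ (n := k) (abs_nonneg _) h1,
              pow_nonneg (abs_nonneg (X i ω)) (k + 3)]
          · linarith [pow_le_pow_right₀ h1 (show k ≤ k + 3 by omega)]
      _ = 1 + ∫ ω, |X i ω| ^ (k + 3) ∂μ := by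
          rw [integral_add (integrable_const _) (h i).1]
          simp
      _ ≤ 1 + α := by linarith [(h i).2]
  choose M hM using hbound
  exact ⟨M, hindep, hmean, hvar, hmoments, fun k i => hM k i⟩

theorem IsFamily.comp_val {M : ℕ → ℝ} {X : ℕ → Ω → ℝ} (hX : IsFamily μ M X) (n : ℕ) :
    IsFamily μ M fun i : Fin n => X i :=
  ⟨hX.indep.precomp Fin.val_injective, fun _ => hX.mean _, fun _ => hX.var _,
    fun _ => hX.hasMoments _, fun _ _ => hX.bound _ _⟩

theorem IsFamily.hasMoments_linStat {M : ℕ → ℝ} {X : ℕ → Ω → ℝ} (hX : IsFamily μ M X) (d : ℕ)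
    (hd : 2 ≤ d) (a : ℕ → ℝ) (n : ℕ) : HasMoments μ (linStat X d a n) := by
  rcases Nat.eq_zero_or_pos n with rfl | hn
  · have : linStat X d a 0 = fun _ => 0 := by
      funext ω
      simp [linStat, Matrix.trace]
    rw [this]
    exact HasMoments.const 0
  · have : NeZero n := ⟨hn.ne'⟩
    rw [funext (linStat_eq X d hd a n)]
    exact ((hX.comp_val n).hasMoments_combo _ _ _).const_mul _

theorem tendsto_div_sqrt_natCast (C : ℝ) :
    Tendsto (fun n : ℕ => C / √(n : ℝ)) atTop (𝓝 0) :=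
  Tendsto.div_atTop tendsto_const_nhds (Real.tendsto_sqrt_atTop.comp tendsto_natCast_atTop_atTop)

/-- The normalised, uncentred statistic. -/
noncomputable def normStat (X : ℕ → Ω → ℝ) (d : ℕ) (a : ℕ → ℝ) (n : ℕ) (ω : Ω) : ℝ :=
  linStat X d a n ω / √(n : ℝ)

theorem normStat_eq (X : ℕ → Ω → ℝ) (d : ℕ) (hd : 2 ≤ d) (a : ℕ → ℝ) (n : ℕ) [NeZero n] (ω : Ω) :
    normStat X d a n ω = combo (fun i : Fin n => X i)
      (scaled (fun k => a (k + 2)) √(Fintype.card (Fin n) : ℝ))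
      (d - 1) (fun k => zeroSum (Fin n) (Fin (k + 2))) ω := by
  have hn : √(n : ℝ) ≠ 0 := (Real.sqrt_pos.2 (Nat.cast_pos.2 (NeZero.pos n))).ne'
  rw [normStat, linStat_eq X d hd, mul_div_cancel_left₀ _ hn, Fintype.card_fin]

theorem IsFamily.tendsto_integral_normStat {M : ℕ → ℝ} {X : ℕ → Ω → ℝ} (hX : IsFamily μ M X)
    (d : ℕ) (hd : 2 ≤ d) (a : ℕ → ℝ) :
    Tendsto (fun n => ∫ ω, normStat X d a n ω ∂μ) atTop (𝓝 0) := by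
  obtain ⟨C, hC⟩ := exists_abs_integral_le μ M (fun k => a (k + 2)) (d - 1)
  refine squeeze_zero_norm' ?_ (tendsto_div_sqrt_natCast C)
  filter_upwards [eventually_gt_atTop 0] with n hn
  have : NeZero n := ⟨hn.ne'⟩
  have := isAddCyclic_fin n
  simp only [normStat_eq X d hd a n]
  simpa using hC (hX.comp_val n)

theorem limitVariance_nonneg (α : ℕ → ℝ) (D : ℕ) : 0 ≤ limitVariance α D :=
  sum_nonneg fun k _ => by positivity

theorem IsFamily.tendsto_integral_exp_normStat {M : ℕ → ℝ} {X : ℕ → Ω → ℝ} (hX : IsFamily μ M X)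
    (d : ℕ) (hd : 2 ≤ d) (a : ℕ → ℝ) (t : ℝ) :
    Tendsto (fun n => ∫ ω, Complex.exp ((t * normStat X d a n ω : ℝ) * Complex.I) ∂μ) atTop
      (𝓝 (Complex.exp ((-(limVar d a * t ^ 2 / 2) : ℝ)))) := by
  obtain ⟨C, hC0, hC⟩ := exists_norm_integral_mul_exp_sub_le μ M (fun k => a (k + 2)) (d - 1)
  rw [limVar_eq d hd]
  set v := limitVariance (fun k => a (k + 2)) (d - 1)
  have hv : 0 ≤ v := limitVariance_nonneg _ _
  have hlim : Tendsto (fun n : ℕ => Real.exp (v * t ^ 2 / 2) *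
      ((1 + |t| + 3 * t ^ 2) * (C / √(n : ℝ))) * |t|) atTop (𝓝 0) := by
    have := (((tendsto_div_sqrt_natCast C).const_mul (1 + |t| + 3 * t ^ 2)).const_mul
      (Real.exp (v * t ^ 2 / 2))).mul_const |t|
    simpa using this
  have h1 : Tendsto (fun n => Complex.exp ((v * t ^ 2 / 2 : ℝ)) *
      ∫ ω, Complex.exp ((t * normStat X d a n ω : ℝ) * Complex.I) ∂μ) atTop (𝓝 1) := by
    rw [tendsto_iff_norm_sub_tendsto_zero]
    refine squeeze_zero' (.of_forall fun n => norm_nonneg _) ?_ hlim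
    filter_upwards [eventually_gt_atTop 0] with n hn
    have : NeZero n := ⟨hn.ne'⟩
    have := isAddCyclic_fin n
    have hT : HasMoments μ (normStat X d a n) := by
      rw [funext (normStat_eq X d hd a n)]
      exact (hX.comp_val n).hasMoments_combo _ _ _
    refine hT.norm_exp_mul_integral_sub_one_le hv (by positivity) (fun u => ?_) t
    have := hC (hX.comp_val n) (normStat_eq X d hd a n) u
    rwa [Fintype.card_fin] at this
  have h2 := h1.const_mul (Complex.exp ((-(v * t ^ 2 / 2) : ℝ)))
  rw [mul_one] at h2
  refine h2.congr fun n => ?_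
  rw [← mul_assoc, ← Complex.exp_add]
  simp

theorem IsFamily.tendsto_charFun {M : ℕ → ℝ} {X : ℕ → Ω → ℝ} (hX : IsFamily μ M X)
    (d : ℕ) (hd : 2 ≤ d) (a : ℕ → ℝ) (t : ℝ) :
    Tendsto (fun n : ℕ => charFun (μ.map fun ω =>
        (linStat X d a n ω - ∫ ω', linStat X d a n ω' ∂μ) / √(n : ℝ)) t) atTop
      (𝓝 (charFun (gaussianReal 0 (limVar d a).toNNReal) t)) := by
  have hvar : 0 ≤ limVar d a := limVar_eq d hd a ▸ limitVariance_nonneg _ _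
  have hmean : Tendsto (fun n => Complex.exp ((-(t * ∫ ω, normStat X d a n ω ∂μ) : ℝ) * Complex.I))
      atTop (𝓝 1) := by
    have h := ((hX.tendsto_integral_normStat d hd a).const_mul t).neg
    rw [mul_zero, neg_zero] at h
    have h' := ((Complex.continuous_ofReal.tendsto 0).comp h).mul_const Complex.I
    simpa [Function.comp_def] using (Complex.continuous_exp.tendsto _).comp h'
  have hlim := hmean.mul (hX.tendsto_integral_exp_normStat d hd a t)
  rw [charFun_gaussianReal]
  convert! hlim using 1
  · funext n
    have hm := hX.hasMoments_linStat d hd a n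
    rw [charFun_apply_real, integral_map ((hm.1.sub_const _).div_const _).aemeasurable
      (by fun_prop), ← integral_const_mul]
    refine integral_congr_ae (ae_of_all _ fun ω => ?_)
    simp only
    rw [← Complex.exp_add]
    congr 1
    have : ∫ ω, normStat X d a n ω ∂μ = (∫ ω, linStat X d a n ω ∂μ) / √(n : ℝ) := integral_div _ _
    rw [this, normStat]
    push_cast
    ring
  · rw [one_mul, Real.coe_toNNReal _ hvar]
    congr 2
    push_cast
    ring

end Main

end CirculantCLT

theorem theorem1 {Ω : Type*} [MeasurableSpace Ω] (μ : Measure Ω) [IsProbabilityMeasure μ]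
    (X : ℕ → Ω → ℝ) (hmeas : ∀ i, Measurable (X i)) (hindep : iIndepFun X μ)
    (hmean : ∀ i, ∫ ω, X i ω ∂μ = 0)
    (hvar : ∀ i, ∫ ω, X i ω ^ 2 ∂μ = 1)
    (hmom : ∀ k : ℕ, 3 ≤ k → ∃ α : ℝ, ∀ i,
      Integrable (fun ω => |X i ω| ^ k) μ ∧ ∫ ω, |X i ω| ^ k ∂μ ≤ α)
    (d : ℕ) (hd : 2 ≤ d) (a : ℕ → ℝ) :
    (∀ n, Integrable (CirculantCLT.linStat X d a n) μ) ∧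
    0 ≤ CirculantCLT.limVar d a ∧
    TendstoInDistribution
      (fun (n : ℕ) (ω : Ω) =>
        (CirculantCLT.linStat X d a n ω - ∫ ω', CirculantCLT.linStat X d a n ω' ∂μ) / √(n : ℝ))
      atTop id (fun _ => μ) (gaussianReal 0 (CirculantCLT.limVar d a).toNNReal) := by
  obtain ⟨M, hX⟩ := CirculantCLT.exists_isFamily hmeas hindep hmean hvar hmom
  have hm := hX.hasMoments_linStat d hd a
  refine ⟨fun n => (hm n).integrable, ?_, ?_⟩
  · rw [CirculantCLT.limVar_eq d hd]
    exact CirculantCLT.limitVariance_nonneg _ _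
  · exact
      { forall_aemeasurable := fun n => (((hm n).1.sub_const _).div_const _).aemeasurable
        aemeasurable_limit := aemeasurable_id
        tendsto := by
          refine ProbabilityMeasure.tendsto_iff_tendsto_charFun.2 fun t => ?_
          simpa using hX.tendsto_charFun d hd a t }
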